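/- Let $X,Y$ be real Banach spaces, $X$ reflexive, $\Omega\subseteq X$ open, $F:\Omega\to Y$ continuously Fréchet differentiable, $C\subseteq Y$ a nonempty closed convex cone. For $z\in\Omega$ let $T_z d:=F'(z)d-C$ and $T_z^{-1}y:=\{d\in X: F'(z)d-y\in C\}$. For a set $S$ put $\|S\|:=\inf_{v\in S}\|v\|$ ($+\infty$ if $S=\varnothing$), and for a set-valued map $T$ put $\|T\|:=\sup\{\|Td\|: Td\ne\varnothing,\ \|d\|\le 1\}$. Let $x_0\in\Omega$ satisfy Robinson's condition, i.e. $T_{x_0}$ has range $Y$. Let $R>0$ and let $f:[0,R)\to\mathbb R$ be a majorant function for $F$ at $x_0$: $f$ is $C^1$, $B(x_0,R)\subseteq\Omega$, $$\|T_{x_0}^{-1}[F'(y)-F'(x)]\|\le f'(\|x-x_0\|+\|y-x\|)-f'(\|x-x_0\|)$$ whenever $x,y\in B(x_0,R)$ and $\|x-x_0\|+\|y-x\|<R$; $f(0)>0$, $f'(0)=-1$; $f'$ is convex and strictly increasing; and $f$ has a zero in $(0,R)$. Assume $\|T_{x_0}^{-1}[-F(x_0)]\|\le f(0)$. Let $\beta:=\sup_{t\in[0,R)}(-f(t))$,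 let $0\le\rho<\beta/2$, and put $$\kappa_\rho:=\sup_{\rho<t<R}\frac{-(f(t)+2\rho)}{|f'(\rho)|(t-\rho)},\qquad \lambda_\rho:=\sup\{t\in[\rho,R):\kappa_\rho+f'(t)<0\},\qquad \tilde\theta_\rho:=\frac{\kappa_\rho}{2-\kappa_\rho},$$ $$\mu_\rho:=\sup\Big\{t\in[0,R-\rho):\kappa_\rho+\frac{f'(t+\rho)}{|f'(\rho)|}<0\Big\}$$ (so $\mu_0=\lambda_0$). Let $0\le\theta\le\tilde\theta_\rho$, and let $z_0\in B(x_0,\rho)$ or $z_0=x_0$ (the latter being the case $\rho=0$). Consider the inexact Newton method $z_{k+1}=z_k+d_k$, where $$d_k\in\operatorname*{argmin}_{d\in X}\{\|d\|: F(z_k)+F'(z_k)d+r_k\in C\},\qquad \max_{w\in\{-r_k,r_k\}}\|T_{x_0}^{-1}w\|\le\theta\,\|T_{x_0}^{-1}[-F(z_k)]\|.$$ Then the method is well defined for every choice of the $r_k$ and $d_k$: after any finite number of steps the iterate $z_k$ lies in $\Omega$, an admissible $r_k$ exists, and for every admissible $r_k$ a minimizer $d_k$ exists. Every sequence $\{z_k\}$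 generated by it satisfies, for all $k\ge0$, $$\|T_{z_0}^{-1}[-F(z_k)]\|\le\Big(\frac{1+\theta^2}{2}\Big)^k[f(0)+2\rho],\qquad z_k\in B(z_0,\lambda_\rho)\cap B(z_0,\mu_\rho),$$ and converges to a point $x_*\in B[x_0,\lambda_\rho]\cap B[z_0,\mu_\rho]\cap\Omega$ with $F(x_*)\in C$. Moreover, if $\mu_\rho<R-\rho$, then for all $k\ge1$ $$\|z_k-z_{k+1}\|\le\frac{1+\theta}{1-\theta}\Big[\frac{1+\theta}{2}\,\frac{D^-f'(\mu_\rho+\rho)}{|f'(\mu_\rho+\rho)|}\,\|z_k-z_{k-1}\|+\theta\,\frac{2|f'(\rho)|+f'(\mu_\rho+\rho)}{|f'(\mu_\rho+\rho)|}\Big]\|z_k-z_{k-1}\|,$$ where $D^-$ is the left derivative. If, additionally, $0\le\theta<\big[-2(\kappa_\rho+1)+\sqrt{4(\kappa_\rho+1)^2+\kappa_\rho(4+\kappa_\rho)}\,\big]/[4+\kappa_\rho]$, then $\{z_k\}$ converges $Q$-linearly: $$\limsup_{k\to\infty}\frac{\|x_*-z_{k+1}\|}{\|x_*-z_k\|}\le\frac{1+\theta}{1-\theta}\Big[\frac{1+\theta}{2}+\frac{2\theta}{\kappa_\rho}\Big]<1$$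 (with $0/0:=0$ if $x_*$ is reached after finitely many steps). -/

import Mathlib

open Set Filter Topology
open scoped ENNReal

namespace ConeNewton

/-- A normed space is reflexive: the canonical embedding into its bidual is onto. -/
def IsReflexiveSpace (X : Type*) [NormedAddCommGroup X] [NormedSpace ℝ X] : Prop :=
  Function.Surjective (NormedSpace.inclusionInDoubleDual ℝ X)

section SetValued

variable {X Y Z : Type*} [NormedAddCommGroup X] [NormedSpace ℝ X]
  [NormedAddCommGroup Y] [NormedSpace ℝ Y] [NormedAddCommGroup Z] [NormedSpace ℝ Z]

/-- The inverse of a set-valued map. -/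
def setInverse (T : X → Set Y) : Y → Set X := fun y => {d | y ∈ T d}

/-- The range of a set-valued map. -/
def setRange (T : X → Set Y) : Set Y := {y | ∃ x, y ∈ T x}

/-- `inf {‖v‖ : v ∈ S}`, with the value `+∞` for the empty set. -/
noncomputable def setNorm (S : Set X) : ℝ≥0∞ := ⨅ v ∈ S, ‖v‖ₑ

/-- The inner norm of a set-valued map, the supremum of `‖T d‖` over all `d` in the domain
of `T` with `‖d‖ ≤ 1`. -/
noncomputable def processNorm (T : X → Set Y) : ℝ≥0∞ :=
  ⨆ d ∈ {d : X | (T d).Nonempty ∧ ‖d‖ ≤ 1}, setNorm (T d)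

/-- The composition `U A` of a set-valued map `U` with a bounded linear map `A`. -/
def compLinear (U : Y → Set Z) (A : X →L[ℝ] Y) : X → Set Z := fun d => U (A d)

/-- The convex process `T_z d = F'(z) d - C`. -/
def linProcess (F : X → Y) (C : ConvexCone ℝ Y) (z : X) : X → Set Y :=
  fun d => {y | ∃ c ∈ C, y = fderiv ℝ F z d - c}

/-- The inverse process `T_z⁻¹`. -/
def invProcess (F : X → Y) (C : ConvexCone ℝ Y) (z : X) : Y → Set X :=
  setInverse (linProcess F C z)

theorem mem_invProcess (F : X → Y) (C : ConvexCone ℝ Y) (z : X) (y : Y) (d : X) :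
    d ∈ invProcess F C z y ↔ fderiv ℝ F z d - y ∈ C := by
  constructor
  · rintro ⟨c, hc, h⟩
    rw [h]
    simpa using hc
  · intro h
    exact ⟨_, h, by abel⟩

/-- Robinson's condition at `x₀`: the range of `T_{x₀}` is the whole space. -/
def RobinsonCondition (F : X → Y) (C : ConvexCone ℝ Y) (x₀ : X) : Prop :=
  setRange (linProcess F C x₀) = univ

/-- The derivative of a real function on `[0, R)` (one-sided at `0`). -/
noncomputable def dIco (f : ℝ → ℝ) (R : ℝ) : ℝ → ℝ := derivWithin f (Ico 0 R)

/-- `f : [0, R) → ℝ` is a majorant function for `F` at `x₀`. -/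
structure IsMajorant (F : X → Y) (Ω : Set X) (C : ConvexCone ℝ Y) (x₀ : X) (R : ℝ)
    (f : ℝ → ℝ) : Prop where
  contDiffOn : ContDiffOn ℝ 1 f (Ico 0 R)
  ball_subset : Metric.ball x₀ R ⊆ Ω
  majorizes : ∀ x ∈ Metric.ball x₀ R, ∀ y ∈ Metric.ball x₀ R, ‖x - x₀‖ + ‖y - x‖ < R →
    processNorm (compLinear (invProcess F C x₀) (fderiv ℝ F y - fderiv ℝ F x)) ≤
      ENNReal.ofReal (dIco f R (‖x - x₀‖ + ‖y - x‖) - dIco f R ‖x - x₀‖)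
  f_zero_pos : 0 < f 0
  deriv_zero : dIco f R 0 = -1
  deriv_convex : ConvexOn ℝ (Ico 0 R) (dIco f R)
  deriv_strictMono : StrictMonoOn (dIco f R) (Ico 0 R)
  exists_zero : ∃ t ∈ Ioo 0 R, f t = 0

/-- The residuals `r` that are admissible at `z` for the relative tolerance `θ`. -/
def Admissible (F : X → Y) (C : ConvexCone ℝ Y) (x₀ : X) (θ : ℝ) (z : X) (r : Y) : Prop :=
  max (setNorm (invProcess F C x₀ (-r))) (setNorm (invProcess F C x₀ r)) ≤
    ENNReal.ofReal θ * setNorm (invProcess F C x₀ (-F z))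

/-- `d` minimizes the norm subject to `F(z) + F'(z) d + r ∈ C`. -/
def IsMinNormStep (F : X → Y) (C : ConvexCone ℝ Y) (z : X) (r : Y) (d : X) : Prop :=
  F z + fderiv ℝ F z d + r ∈ C ∧
    ∀ d' : X, F z + fderiv ℝ F z d' + r ∈ C → ‖d‖ ≤ ‖d'‖

/-- `z'` may follow `z` in the inexact Newton method. -/
def IsNewtonStep (F : X → Y) (C : ConvexCone ℝ Y) (x₀ : X) (θ : ℝ) (z z' : X) : Prop :=
  ∃ (r : Y) (d : X), Admissible F C x₀ θ z r ∧ IsMinNormStep F C z r d ∧ z' = z + d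

end SetValued

/-- `β = sup {-f(t) : t ∈ [0, R)}`. -/
noncomputable def beta (f : ℝ → ℝ) (R : ℝ) : ℝ := sSup ((fun t => -f t) '' Ico 0 R)

/-- `κ_ρ = sup {-(f(t) + 2ρ) / (|f'(ρ)| (t - ρ)) : ρ < t < R}`. -/
noncomputable def kappa (f : ℝ → ℝ) (R ρ : ℝ) : ℝ :=
  sSup ((fun t => -(f t + 2 * ρ) / (|dIco f R ρ| * (t - ρ))) '' Ioo ρ R)

/-- `λ_ρ = sup {t ∈ [ρ, R) : κ_ρ + f'(t) < 0}`. -/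
noncomputable def lam (f : ℝ → ℝ) (R ρ : ℝ) : ℝ :=
  sSup {t | t ∈ Ico ρ R ∧ kappa f R ρ + dIco f R t < 0}

/-- `μ_ρ = sup {t ∈ [0, R - ρ) : κ_ρ + f'(t + ρ) / |f'(ρ)| < 0}`, which is the constant `λ`
of the recentred majorant function `t ↦ (f(t + ρ) + 2ρ) / |f'(ρ)|` on `[0, R - ρ)`. -/
noncomputable def mu (f : ℝ → ℝ) (R ρ : ℝ) : ℝ :=
  sSup {t | t ∈ Ico 0 (R - ρ) ∧ kappa f R ρ + dIco f R (t + ρ) / |dIco f R ρ| < 0}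

/-- `θ̃_ρ = κ_ρ / (2 - κ_ρ)`. -/
noncomputable def thetaMax (f : ℝ → ℝ) (R ρ : ℝ) : ℝ := kappa f R ρ / (2 - kappa f R ρ)

/-- The left derivative `D⁻ f'(t)` of the derivative of `f`. -/
noncomputable def leftDerivD (f : ℝ → ℝ) (R t : ℝ) : ℝ := derivWithin (dIco f R) (Iio t) t

/-- The bound for the `Q`-linear rate. -/
noncomputable def qRate (κ θ : ℝ) : ℝ := (1 + θ) / (1 - θ) * ((1 + θ) / 2 + 2 * θ / κ)

end ConeNewton

/-! Let `N(y)`, called `solNorm`, be the least norm of a solution `d` of `F'(x₀) d - y ∈ C`.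
Robinson's condition and reflexivity make it finite and attained; it is sublinear, a Baire argument
makes it continuous, and `N(-c) = 0` exactly when `c ∈ C`. So `N(-F z)` is a one-sided residual, and
sublinearity replaces linearity in Kantorovich's argument. A Neumann series solves perturbed
inclusions (`exists_of_perturbation`), the linearization error of `F` is bounded in `N` by that of
`f` (`solNorm_linearization_le`), and each Newton step obeys inequalities in the residual, the step
length and a scalar `s ≥ ‖z - x₀‖` only (`newton_step_estimates`).

The iterates are majorized by a scalar recursion: `s = ρ`, `ε = 0` at the start, and with `G = f s +
2ρ + ε` the next pair is `s' = s + (1+θ) G / |f' s|`, `ε' = ε + 2θG`. This choice of `ε` gives `G' =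
θG +` (linearization error of `f`), the recursion satisfied by the residual bound. The condition `θ
≤ κ/(2-κ)` reads `2θ ≤ κ(1+θ)` and yields `ε ≤ κ|f' ρ|(s - ρ)`. Hence `G` lies below `gap`, a
function that is nonnegative on `(ρ, R)` with infimum `0` by the definition of `κ`; the infimum is
approached at the point `σ = μ + ρ` where `f'` reaches `-κ|f' ρ|`. Convexity of `f'` then keeps `s`
below `σ` and bounds the linearization error by `(1-θ)²/2 · G`, so `G` shrinks by `θ + (1-θ)²/2 =
(1+θ²)/2` (`contraction`, `majSeq_invariant`).

The ball about `x₀` and the linear rate need more: `s ≤ λ`, that is `|f' s| ≥ κ` without the factor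
`|f' ρ|` (`majPoint_le_crossing`). It follows by letting `ε` grow at the smaller slope `κ|f' s₁|`
after the first step and using strong convexity of `f` beyond `ρ`. For the rate, residual and
distance to the limit are compared in both directions, while the residual asymptotically contracts
by `θ`. -/

namespace ConeNewton

/-! ### Weak compactness in reflexive spaces -/

section Reflexive

variable {X : Type*} [NormedAddCommGroup X] [NormedSpace ℝ X]

/-- In a reflexive space, a decreasing sequence of nonempty bounded closed convex sets has a
common point. -/
theorem IsReflexiveSpace.nonempty_iInter (hX : IsReflexiveSpace X) (K : ℕ → Set X)
    (hanti : ∀ n, K (n + 1) ⊆ K n) (hne : ∀ n, (K n).Nonempty) (hb : Bornology.IsBounded (K 0))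
    (hcl : ∀ n, IsClosed (K n)) (hcv : ∀ n, Convex ℝ (K n)) : (⋂ n, K n).Nonempty := by
  -- Mazur: closed convex sets are weakly closed. Reflexivity enters below, making the embedding
  -- into the weak-star bidual onto, so that Banach–Alaoglu applies.
  have hwcl : ∀ n, IsClosed (toWeakSpace ℝ X '' K n) := fun n => by
    have h := (hcv n).toWeakSpace_closure ℝ
    rw [(hcl n).closure_eq] at h
    rw [h]
    exact isClosed_closure
  have hrange : Set.range (NormedSpace.inclusionInDoubleDualWeak ℝ X) = univ := by
    rw [Set.range_eq_univ]
    intro ξ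
    obtain ⟨x, hx⟩ := hX (WeakDual.toStrongDual ξ)
    refine ⟨toWeakSpace ℝ X x, ?_⟩
    apply DFunLike.ext
    intro φ
    exact DFunLike.congr_fun hx φ
  have hcpt : IsCompact (toWeakSpace ℝ X '' K 0) := by
    have := NormedSpace.isCompact_closure_of_isBounded ℝ X (toWeakSpace ℝ X '' K 0)
      (by rwa [Set.preimage_image_eq _ (toWeakSpace ℝ X).injective]) (by rw [hrange]; simp)
    rwa [(hwcl 0).closure_eq] at this
  obtain ⟨x, hx⟩ := IsCompact.nonempty_iInter_of_sequence_nonempty_isCompact_isClosed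
    (fun n => toWeakSpace ℝ X '' K n) (fun n => Set.image_mono (hanti n))
    (fun n => (hne n).image _) hcpt hwcl
  refine ⟨(toWeakSpace ℝ X).symm x, mem_iInter.2 fun n => ?_⟩
  obtain ⟨y, hy, rfl⟩ := mem_iInter.1 hx n
  simpa using hy

/-- A nonempty closed convex subset of a reflexive space has an element of minimal norm. -/
theorem IsReflexiveSpace.exists_norm_min (hX : IsReflexiveSpace X) {K : Set X}
    (hne : K.Nonempty) (hcl : IsClosed K) (hcv : Convex ℝ K) :
    ∃ d ∈ K, ∀ d' ∈ K, ‖d‖ ≤ ‖d'‖ := by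
  set m := sInf (norm '' K) with hm
  have hbdd : BddBelow (norm '' K) := ⟨0, by rintro _ ⟨x, -, rfl⟩; exact norm_nonneg x⟩
  obtain ⟨d, hd⟩ := hX.nonempty_iInter
    (fun n : ℕ => K ∩ Metric.closedBall 0 (m + 1 / ((n : ℝ) + 1)))
    (fun n => by
      apply inter_subset_inter_right
      apply Metric.closedBall_subset_closedBall
      have := Nat.one_div_le_one_div (α := ℝ) (Nat.le_succ n)
      push_cast at this ⊢
      simpa using this)
    (fun n => by
      have h : m < m + 1 / ((n : ℝ) + 1) := by
        have : 0 < 1 / ((n : ℝ) + 1) := by positivity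
        linarith
      obtain ⟨_, ⟨x, hx, rfl⟩, hlt⟩ := exists_lt_of_csInf_lt (hne.image norm) h
      exact ⟨x, hx, by simpa using hlt.le⟩)
    (Metric.isBounded_closedBall.subset inter_subset_right)
    (fun n => hcl.inter Metric.isClosed_closedBall)
    (fun n => hcv.inter (convex_closedBall _ _))
  have hd' := fun n => mem_iInter.1 hd n
  refine ⟨d, (hd' 0).1, fun d' h' => ?_⟩
  have h1 : ‖d‖ ≤ m := by
    have ht : Tendsto (fun n : ℕ => m + 1 / ((n : ℝ) + 1)) atTop (𝓝 (m + 0)) :=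
      tendsto_const_nhds.add tendsto_one_div_add_atTop_nhds_zero_nat
    rw [add_zero] at ht
    exact ge_of_tendsto' ht fun n => by simpa using (hd' n).2
  exact h1.trans (csInf_le hbdd ⟨d', h', rfl⟩)

end Reflexive

/-! ### The sublinear functional of least solutions of a cone inclusion -/

section SolNorm

variable {X Y : Type*} [NormedAddCommGroup X] [NormedSpace ℝ X]
  [NormedAddCommGroup Y] [NormedSpace ℝ Y]

/-- The least norm of a solution `d` of the cone inclusion `A d - y ∈ C`. -/
noncomputable def solNorm (A : X →L[ℝ] Y) (C : ConvexCone ℝ Y) (y : Y) : ℝ :=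
  sInf (norm '' {d : X | A d - y ∈ C})

/-- The inclusions `A d - y ∈ C` are solvable for every right-hand side, for a closed convex cone
`C` and a reflexive space of unknowns. -/
structure SolvableInclusion (A : X →L[ℝ] Y) (C : ConvexCone ℝ Y) : Prop where
  reflexive : IsReflexiveSpace X
  closed : IsClosed (C : Set Y)
  zero_mem : (0 : Y) ∈ C
  surj : ∀ y, ∃ d, A d - y ∈ C

theorem zero_mem_of_isClosed {C : ConvexCone ℝ Y} (hne : (C : Set Y).Nonempty)
    (hcl : IsClosed (C : Set Y)) : (0 : Y) ∈ C := by
  obtain ⟨c, hc⟩ := hne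
  have ht : Tendsto (fun t : ℝ => t • c) (𝓝[>] 0) (𝓝 ((0 : ℝ) • c)) :=
    ((continuous_id.smul continuous_const).tendsto (0 : ℝ)).mono_left nhdsWithin_le_nhds
  rw [zero_smul] at ht
  refine hcl.mem_of_tendsto ht ?_
  filter_upwards [self_mem_nhdsWithin] with t ht
  exact C.smul_mem ht hc

theorem convex_solSet (A : X →L[ℝ] Y) (C : ConvexCone ℝ Y) (y : Y) :
    Convex ℝ {d : X | A d - y ∈ C} := by
  have h : {d : X | A d - y ∈ C} = A ⁻¹' ((fun z => z + -y) ⁻¹' (C : Set Y)) := by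
    ext d
    simp [sub_eq_add_neg]
  rw [h]
  exact (C.convex.translate_preimage_left _).linear_preimage A.toLinearMap

namespace SolvableInclusion

variable {A : X →L[ℝ] Y} {C : ConvexCone ℝ Y}

theorem isClosed_solSet (h : SolvableInclusion A C) (y : Y) :
    IsClosed {d : X | A d - y ∈ C} :=
  h.closed.preimage (A.continuous.sub continuous_const)

theorem exists_min (h : SolvableInclusion A C) (y : Y) :
    ∃ d, A d - y ∈ C ∧ ‖d‖ = solNorm A C y := by
  obtain ⟨d, hd, hmin⟩ := h.reflexive.exists_norm_min (h.surj y) (h.isClosed_solSet y)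
    (convex_solSet A C y)
  refine ⟨d, hd, le_antisymm ?_ ?_⟩
  · refine le_csInf ⟨_, d, hd, rfl⟩ ?_
    rintro _ ⟨d', hd', rfl⟩
    exact hmin d' hd'
  · exact csInf_le ⟨0, by rintro _ ⟨x, -, rfl⟩; exact norm_nonneg x⟩ ⟨d, hd, rfl⟩

end SolvableInclusion

theorem solNorm_le {A : X →L[ℝ] Y} {C : ConvexCone ℝ Y} {y : Y} {d : X} (hd : A d - y ∈ C) :
    solNorm A C y ≤ ‖d‖ :=
  csInf_le ⟨0, by rintro _ ⟨x, -, rfl⟩; exact norm_nonneg x⟩ ⟨d, hd, rfl⟩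

theorem solNorm_nonneg (A : X →L[ℝ] Y) (C : ConvexCone ℝ Y) (y : Y) : 0 ≤ solNorm A C y :=
  Real.sInf_nonneg (by rintro _ ⟨x, -, rfl⟩; exact norm_nonneg x)

namespace SolvableInclusion

variable {A : X →L[ℝ] Y} {C : ConvexCone ℝ Y}

theorem setNorm_eq (h : SolvableInclusion A C) (y : Y) :
    setNorm {d : X | A d - y ∈ C} = ENNReal.ofReal (solNorm A C y) := by
  obtain ⟨d, hd, hn⟩ := h.exists_min y
  apply le_antisymm
  · rw [← hn, ofReal_norm]
    exact iInf₂_le d hd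
  · refine le_iInf₂ fun d' hd' => ?_
    rw [← ofReal_norm]
    exact ENNReal.ofReal_le_ofReal (solNorm_le hd')

theorem solNorm_add_le (h : SolvableInclusion A C) (y z : Y) :
    solNorm A C (y + z) ≤ solNorm A C y + solNorm A C z := by
  obtain ⟨d, hd, hn⟩ := h.exists_min y
  obtain ⟨e, he, hm⟩ := h.exists_min z
  rw [← hn, ← hm]
  refine (solNorm_le (d := d + e) ?_).trans (norm_add_le d e)
  have : A (d + e) - (y + z) = (A d - y) + (A e - z) := by rw [map_add]; abel
  rw [this]
  exact C.add_mem hd he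

theorem solNorm_neg_eq_zero (_ : SolvableInclusion A C) {c : Y} (hc : c ∈ C) :
    solNorm A C (-c) = 0 := by
  refine le_antisymm ?_ (solNorm_nonneg _ _ _)
  simpa using solNorm_le (A := A) (C := C) (y := -c) (d := 0) (by simpa using hc)

theorem solNorm_zero (h : SolvableInclusion A C) : solNorm A C 0 = 0 := by
  simpa using h.solNorm_neg_eq_zero h.zero_mem

theorem mem_of_solNorm_neg_eq_zero (h : SolvableInclusion A C) {c : Y}
    (hc : solNorm A C (-c) = 0) : c ∈ C := by
  obtain ⟨d, hd, hn⟩ := h.exists_min (-c)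
  rw [hc, norm_eq_zero] at hn
  simpa [hn] using hd

theorem solNorm_smul_le (h : SolvableInclusion A C) {t : ℝ} (ht : 0 ≤ t) (y : Y) :
    solNorm A C (t • y) ≤ t * solNorm A C y := by
  rcases ht.eq_or_lt with rfl | ht
  · simp [h.solNorm_zero]
  obtain ⟨d, hd, hn⟩ := h.exists_min y
  rw [← hn]
  have := solNorm_le (A := A) (C := C) (y := t • y) (d := t • d) (by
    rw [map_smul, ← smul_sub]
    exact C.smul_mem ht hd)
  rwa [norm_smul, Real.norm_of_nonneg ht.le] at this

theorem solNorm_apply_le (h : SolvableInclusion A C) (d : X) : solNorm A C (A d) ≤ ‖d‖ :=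
  solNorm_le (by simpa using h.zero_mem)

/-- Lower semicontinuity without continuity: least solutions for the approximating right-hand sides
lie in a fixed ball and solve the limit inclusion up to a thickening of `C`. By reflexivity the
nested bounded closed convex sets so obtained share a point, which solves it exactly. -/
theorem isClosed_sublevel (h : SolvableInclusion A C) (r : ℝ) :
    IsClosed {y | solNorm A C y ≤ r} := by
  rw [← isSeqClosed_iff_isClosed]
  intro u y hu hy
  obtain ⟨d, hd⟩ := h.reflexive.nonempty_iInter
    (fun n : ℕ => Metric.closedBall 0 r ∩
      (fun d => A d - y) ⁻¹' Metric.cthickening (1 / ((n : ℝ) + 1)) (C : Set Y))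
    (fun n => by
      apply inter_subset_inter_right
      apply preimage_mono
      apply Metric.cthickening_mono
      have := Nat.one_div_le_one_div (α := ℝ) (Nat.le_succ n)
      push_cast at this ⊢
      simpa using this)
    (fun n => by
      have hpos : 0 < 1 / ((n : ℝ) + 1) := by positivity
      obtain ⟨k, hk⟩ := (Metric.tendsto_atTop.1 hy _ hpos)
      obtain ⟨d, hd, hn⟩ := h.exists_min (u k)
      refine ⟨d, by simpa [hn] using hu k, ?_⟩
      refine Metric.mem_cthickening_of_dist_le _ (A d - u k) _ _ hd ?_
      have := (hk k le_rfl).le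
      rwa [dist_sub_left, dist_comm])
    (Metric.isBounded_closedBall.subset inter_subset_left)
    (fun n => Metric.isClosed_closedBall.inter
      (Metric.isClosed_cthickening.preimage (A.continuous.sub continuous_const)))
    (fun n => by
      refine (convex_closedBall _ _).inter ?_
      have e : (fun d => A d - y) ⁻¹' Metric.cthickening (1 / ((n : ℝ) + 1)) (C : Set Y) =
          A ⁻¹' ((fun z => z + -y) ⁻¹' Metric.cthickening (1 / ((n : ℝ) + 1)) (C : Set Y)) := by
        ext d
        simp [sub_eq_add_neg]
      rw [e]
      exact ((C.convex.cthickening _).translate_preimage_left _).linear_preimage A.toLinearMap)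
  have hd' := fun n => mem_iInter.1 hd n
  have hmem : A d - y ∈ C := by
    rw [← SetLike.mem_coe, ← h.closed.closure_eq, Metric.closure_eq_iInter_cthickening]
    refine mem_iInter₂.2 fun ε hε => ?_
    obtain ⟨n, hn⟩ := exists_nat_one_div_lt hε
    exact Metric.cthickening_mono hn.le _ (hd' n).2
  exact (solNorm_le hmem).trans (by simpa using (hd' 0).1)

/-- The open mapping theorem for this convex process. By Baire some sublevel set contains a ball
about a point `y₀`; writing `v = (y₀ + v) + (-y₀)` moves the bound to a ball about `0`, and
homogeneity spreads it. -/
theorem exists_bound [CompleteSpace Y] (h : SolvableInclusion A C) :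
    ∃ c : ℝ, 0 ≤ c ∧ ∀ y, solNorm A C y ≤ c * ‖y‖ := by
  obtain ⟨n, y₀, hy₀⟩ := nonempty_interior_of_iUnion_of_closed
    (f := fun n : ℕ => {y | solNorm A C y ≤ n}) (fun n => h.isClosed_sublevel n) (by
      refine eq_univ_of_forall fun y => mem_iUnion.2 ?_
      exact exists_nat_ge (solNorm A C y))
  obtain ⟨ε, hε, hball⟩ := Metric.mem_nhds_iff.1 (mem_interior_iff_mem_nhds.1 hy₀)
  set M := (n : ℝ) + solNorm A C (-y₀) with hM
  have hM0 : 0 ≤ M := add_nonneg n.cast_nonneg (solNorm_nonneg _ _ _)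
  have hsmall : ∀ v, ‖v‖ < ε → solNorm A C v ≤ M := fun v hv => by
    have h1 : y₀ + v ∈ {y | solNorm A C y ≤ n} := hball (by simpa using hv)
    have := h.solNorm_add_le (y₀ + v) (-y₀)
    rw [add_neg_cancel_comm] at this
    exact this.trans (by rw [hM]; exact add_le_add_left h1 _)
  refine ⟨2 * M / ε, by positivity, fun y => ?_⟩
  by_cases hy : y = 0
  · simp [hy, h.solNorm_zero]
  have hy' : 0 < ‖y‖ := norm_pos_iff.2 hy
  have h1 := hsmall ((ε / (2 * ‖y‖)) • y) (by
    rw [norm_smul, Real.norm_of_nonneg (by positivity)]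
    field_simp
    linarith)
  have h2 := h.solNorm_smul_le (t := 2 * ‖y‖ / ε) (by positivity) ((ε / (2 * ‖y‖)) • y)
  rw [smul_smul, show 2 * ‖y‖ / ε * (ε / (2 * ‖y‖)) = 1 by field_simp, one_smul] at h2
  refine h2.trans ?_
  calc 2 * ‖y‖ / ε * solNorm A C ((ε / (2 * ‖y‖)) • y) ≤ 2 * ‖y‖ / ε * M := by gcongr
    _ = 2 * M / ε * ‖y‖ := by ring

theorem continuous_solNorm [CompleteSpace Y] (h : SolvableInclusion A C) :
    Continuous (solNorm A C) := by
  obtain ⟨c, hc, hb⟩ := h.exists_bound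
  refine (LipschitzWith.of_le_add_mul ⟨c, hc⟩ fun x y => ?_).continuous
  have := h.solNorm_add_le y (x - y)
  rw [add_sub_cancel] at this
  refine this.trans ?_
  rw [dist_eq_norm]
  exact add_le_add_right (hb _) _

/-- Perturbation of solvable inclusions, in the manner of Banach's lemma. -/
theorem exists_of_perturbation [CompleteSpace X] (h : SolvableInclusion A C) {A' : X →L[ℝ] Y}
    {a : ℝ} (ha0 : 0 ≤ a) (ha : a < 1) (hA : ∀ v, solNorm A C ((A' - A) v) ≤ a * ‖v‖) (y : Y) :
    ∃ d, A' d - y ∈ C ∧ ‖d‖ ≤ solNorm A C y / (1 - a) := by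
  choose g hg hgn using h.exists_min
  -- Neumann series with least solutions in place of the inverse: each term corrects the defect that
  -- the previous one leaves in `A'`.
  let e : ℕ → X := fun n => Nat.rec (g y) (fun _ v => g ((A' - A) (-v))) n
  have e0 : e 0 = g y := rfl
  have es : ∀ n, e (n + 1) = g ((A' - A) (-e n)) := fun n => rfl
  have hnorm : ∀ n, ‖e n‖ ≤ solNorm A C y * a ^ n := by
    intro n
    induction n with
    | zero => simp [e0, hgn]
    | succ n ih =>
      rw [es, hgn]
      refine (hA _).trans ?_
      rw [norm_neg, pow_succ]
      calc a * ‖e n‖ ≤ a * (solNorm A C y * a ^ n) := by gcongr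
        _ = _ := by ring
  have hgeo : HasSum (fun n => solNorm A C y * a ^ n) (solNorm A C y / (1 - a)) := by
    simpa [div_eq_mul_inv] using (hasSum_geometric_of_lt_one ha0 ha).mul_left (solNorm A C y)
  have hsum : Summable e := Summable.of_norm_bounded hgeo.summable hnorm
  refine ⟨∑' n, e n, ?_, tsum_of_norm_bounded hgeo hnorm⟩
  -- The perturbation term lags one index behind, so that adding the inclusion for `e (n + 1)`
  -- telescopes; `C + C ⊆ C` is all that is used. In the limit the lag disappears and `A'` appears.
  have hpart : ∀ n, A (∑ i ∈ Finset.range (n + 1), e i) - y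
      + (A' - A) (∑ i ∈ Finset.range n, e i) ∈ C := by
    intro n
    induction n with
    | zero => simpa [e0] using hg y
    | succ n ih =>
      have h1 := C.add_mem ih (hg ((A' - A) (-e n)))
      rw [← es] at h1
      convert h1 using 1
      rw [Finset.sum_range_succ _ (n + 1), Finset.sum_range_succ (f := e) (n := n)]
      simp only [map_add, map_neg]
      abel
  have ht := hsum.hasSum.tendsto_sum_nat
  have ht1 := (tendsto_add_atTop_iff_nat 1).2 ht
  have hlim := (((A.continuous.tendsto _).comp ht1).sub_const y).add
    (((A' - A).continuous.tendsto _).comp ht)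
  have := h.closed.mem_of_tendsto hlim (Eventually.of_forall hpart)
  have e' : A (∑' n, e n) - y + (A' - A) (∑' n, e n) = A' (∑' n, e n) - y := by
    simp only [sub_apply]
    abel
  rwa [e'] at this

end SolvableInclusion

end SolNorm

/-! ### Calculus of functions with convex derivative -/

/-- A differentiable function on `[0, R)` with continuous, convex and strictly increasing derivative
`D` normalized by `D 0 = -1`. -/
structure ConvexDerivOn (f D : ℝ → ℝ) (R : ℝ) : Prop where
  hasDeriv : ∀ t ∈ Ico 0 R, HasDerivWithinAt f (D t) (Ico 0 R) t
  cont : ContinuousOn D (Ico 0 R)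
  convex : ConvexOn ℝ (Ico 0 R) D
  strictMono : StrictMonoOn D (Ico 0 R)
  zero : D 0 = -1

namespace ConvexDerivOn

variable {f D : ℝ → ℝ} {R a b c m : ℝ}

theorem continuousOn (H : ConvexDerivOn f D R) : ContinuousOn f (Ico 0 R) :=
  fun t ht => (H.hasDeriv t ht).continuousWithinAt

theorem hasDerivWithinAt_Ici (H : ConvexDerivOn f D R) {t : ℝ} (ht : t ∈ Ico 0 R) :
    HasDerivWithinAt f (D t) (Ici t) t := by
  refine (H.hasDeriv t ht).mono_of_mem_nhdsWithin ?_
  exact mem_of_superset (Ico_mem_nhdsGE ht.2) (Ico_subset_Ico_left ht.1)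

theorem le_quadratic (H : ConvexDerivOn f D R) (ha : 0 ≤ a) (hab : a ≤ b) (hb : b < R)
    (hm : ∀ y ∈ Icc a b, D y ≤ D a + m * (y - a)) :
    f b ≤ f a + D a * (b - a) + m * (b - a) ^ 2 / 2 := by
  have hsub : Icc a b ⊆ Ico 0 R := fun y hy => ⟨ha.trans hy.1, hy.2.trans_lt hb⟩
  have hder : ∀ x, HasDerivAt (fun t => f a + D a * (t - a) + m * (t - a) ^ 2 / 2)
      (D a + m * (x - a)) x := fun x => by
    have h1 := ((((hasDerivAt_id x).sub_const a).const_mul (D a)).const_add (f a)).add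
      ((((hasDerivAt_id x).sub_const a).pow 2).const_mul m |>.div_const 2)
    refine h1.congr_deriv ?_
    simp
    ring
  refine image_le_of_deriv_right_le_deriv_boundary (f := f) (f' := D) (H.continuousOn.mono hsub)
    (fun x hx => H.hasDerivWithinAt_Ici (hsub ⟨hx.1, hx.2.le⟩)) (by simp)
    (fun x _ => (hder x).continuousAt.continuousWithinAt) (fun x _ => (hder x).hasDerivWithinAt)
    (fun x hx => hm x ⟨hx.1, hx.2.le⟩) ⟨hab, le_rfl⟩

theorem quadratic_le (H : ConvexDerivOn f D R) (ha : 0 ≤ a) (hab : a ≤ b) (hb : b < R)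
    (hm : ∀ y ∈ Icc a b, D a + m * (y - a) ≤ D y) :
    f a + D a * (b - a) + m * (b - a) ^ 2 / 2 ≤ f b := by
  have hsub : Icc a b ⊆ Ico 0 R := fun y hy => ⟨ha.trans hy.1, hy.2.trans_lt hb⟩
  have hder : ∀ x, HasDerivAt (fun t => f a + D a * (t - a) + m * (t - a) ^ 2 / 2)
      (D a + m * (x - a)) x := fun x => by
    have h1 := ((((hasDerivAt_id x).sub_const a).const_mul (D a)).const_add (f a)).add
      ((((hasDerivAt_id x).sub_const a).pow 2).const_mul m |>.div_const 2)
    refine h1.congr_deriv ?_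
    simp
    ring
  exact image_le_of_deriv_right_le_deriv_boundary
    (f := fun t => f a + D a * (t - a) + m * (t - a) ^ 2 / 2) (B := f) (B' := D)
    (fun x _ => (hder x).continuousAt.continuousWithinAt) (fun x _ => (hder x).hasDerivWithinAt)
    (by simp) (H.continuousOn.mono hsub)
    (fun x hx => H.hasDerivWithinAt_Ici (hsub ⟨hx.1, hx.2.le⟩))
    (fun x hx => hm x ⟨hx.1, hx.2.le⟩) ⟨hab, le_rfl⟩

theorem mono (H : ConvexDerivOn f D R) (ha : 0 ≤ a) (hab : a ≤ b) (hb : b < R) : D a ≤ D b :=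
  H.strictMono.monotoneOn ⟨ha, hab.trans_lt hb⟩ ⟨ha.trans hab, hb⟩ hab

theorem tangent_le_right (H : ConvexDerivOn f D R) (ha : 0 ≤ a) (hab : a ≤ b) (hb : b < R) :
    f a + D a * (b - a) ≤ f b := by
  simpa using H.quadratic_le (m := 0) ha hab hb
    (fun y hy => by simpa using H.mono ha hy.1 (hy.2.trans_lt hb))

/-- The inner points `a + c` and `b` are convex combinations of `a` and `b + c` with complementary
weights, so the two convexity inequalities add up to the claim. -/
theorem concave_diff_mono (H : ConvexDerivOn f D R) (ha : 0 ≤ a) (hab : a ≤ b) (hc : 0 ≤ c)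
    (hR : b + c < R) : D (a + c) - D a ≤ D (b + c) - D b := by
  rcases hc.eq_or_lt with rfl | hc
  · simp
  have hpos : 0 < b + c - a := by linarith
  have hmem1 : a ∈ Ico 0 R := ⟨ha, by linarith⟩
  have hmem2 : b + c ∈ Ico 0 R := ⟨by linarith, hR⟩
  have hw : (b - a) / (b + c - a) + c / (b + c - a) = 1 := by field_simp; ring
  have hn1 : 0 ≤ (b - a) / (b + c - a) := div_nonneg (by linarith) hpos.le
  have hn2 : 0 ≤ c / (b + c - a) := div_nonneg hc.le hpos.le
  have h1 := H.convex.2 hmem1 hmem2 hn1 hn2 hw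
  have h2 := H.convex.2 hmem1 hmem2 hn2 hn1 (by rw [add_comm]; exact hw)
  simp only [smul_eq_mul] at h1 h2
  rw [show (b - a) / (b + c - a) * a + c / (b + c - a) * (b + c) = a + c by field_simp; ring] at h1
  rw [show c / (b + c - a) * a + (b - a) / (b + c - a) * (b + c) = b by field_simp; ring] at h2
  have e : (b - a) / (b + c - a) = 1 - c / (b + c - a) := by linarith
  rw [e] at h1 h2
  linarith

theorem chord (H : ConvexDerivOn f D R) (ha : 0 ≤ a) (hab : a ≤ b) (hbc : b ≤ c) (hc : c < R) :
    (D b - D a) * (c - a) ≤ (D c - D a) * (b - a) := by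
  rcases hab.eq_or_lt with rfl | hab
  · simp
  rcases hbc.eq_or_lt with rfl | hbc
  · rfl
  have hca : 0 < c - a := by linarith
  have hn1 : 0 ≤ (c - b) / (c - a) := div_nonneg (by linarith) hca.le
  have hn2 : 0 ≤ (b - a) / (c - a) := div_nonneg (by linarith) hca.le
  have hac : a ∈ Ico 0 R := ⟨ha, by linarith⟩
  have hcc : c ∈ Ico 0 R := ⟨by linarith, hc⟩
  have h1 := H.convex.2 hac hcc hn1 hn2 (by field_simp; ring)
  simp only [smul_eq_mul] at h1
  rw [show (c - b) / (c - a) * a + (b - a) / (c - a) * c = b by field_simp; ring] at h1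
  have h2 : (c - b) / (c - a) * D a + (b - a) / (c - a) * D c
      = ((c - b) * D a + (b - a) * D c) / (c - a) := by ring
  rw [h2, le_div_iff₀ hca] at h1
  linarith

theorem chord_right (H : ConvexDerivOn f D R) (ha : 0 ≤ a) (hab : a ≤ b) (hbc : b ≤ c)
    (hc : c < R) : (D b - D a) * (c - b) ≤ (D c - D b) * (b - a) := by
  linarith [H.chord ha hab hbc hc]

/-- Upper bound of the linearization error by the chord of the derivative. -/
theorem le_of_chord (H : ConvexDerivOn f D R) (ha : 0 ≤ a) (hab : a ≤ b) (hbc : b ≤ c)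
    (hac : a < c) (hc : c < R) :
    2 * (c - a) * (f b - f a - D a * (b - a)) ≤ (D c - D a) * (b - a) ^ 2 := by
  have hca : 0 < c - a := by linarith
  have h := H.le_quadratic (m := (D c - D a) / (c - a)) ha hab (hbc.trans_lt hc) (fun y hy => by
    have h1 := H.chord ha hy.1 (hy.2.trans hbc) hc
    have h2 : D y - D a ≤ (D c - D a) * (y - a) / (c - a) := (le_div_iff₀ hca).2 h1
    have h3 : (D c - D a) * (y - a) / (c - a) = (D c - D a) / (c - a) * (y - a) := by ring
    linarith)
  have h4 : f b - f a - D a * (b - a) ≤ (D c - D a) * (b - a) ^ 2 / (2 * (c - a)) := by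
    have : (D c - D a) * (b - a) ^ 2 / (2 * (c - a))
        = (D c - D a) / (c - a) * (b - a) ^ 2 / 2 := by field_simp
    linarith
  rw [le_div_iff₀ (by linarith)] at h4
  linarith

/-- Chord slopes of the convex `D` increase from `[0, ρ]` to `[ρ, a]` to `[a, b]`, and the first is
`(D ρ + 1) / ρ`. The inequality is multiplied out to cover `ρ = 0`. -/
theorem slope_le (H : ConvexDerivOn f D R) {ρ : ℝ} (hρ : 0 ≤ ρ) (ha : ρ ≤ a) (hab : a ≤ b)
    (hb : b < R) : (D ρ + 1) * (b - a) ≤ ρ * (D b - D a) := by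
  rw [← sub_neg_eq_add, ← H.zero]
  rcases ha.eq_or_lt with rfl | ha'
  · linarith [H.chord_right le_rfl hρ hab hb]
  · have h1 := H.chord_right le_rfl hρ ha (hab.trans_lt hb)
    have h2 := H.chord_right hρ ha hab hb
    have h3 : 0 < a - ρ := by linarith
    have h4 : 0 ≤ b - a := by linarith
    refine le_of_mul_le_mul_right ?_ h3
    nlinarith [mul_le_mul_of_nonneg_right h1 h4, mul_le_mul_of_nonneg_left h2 hρ]

/-- Strong convexity of `f` to the right of `ρ`. -/
theorem strong_convex (H : ConvexDerivOn f D R) {ρ : ℝ} (hρ : 0 ≤ ρ) (ha : ρ ≤ a) (hab : a ≤ b)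
    (hb : b < R) :
    ρ * (f a + D a * (b - a)) + (D ρ + 1) * (b - a) ^ 2 / 2 ≤ ρ * f b := by
  rcases hρ.eq_or_lt with rfl | hρ'
  · simp [H.zero]
  have h := H.quadratic_le (m := (D ρ + 1) / ρ) (hρ.trans ha) hab hb (fun y hy => by
    have := H.slope_le hρ ha hy.1 (hy.2.trans_lt hb)
    have h2 : (D ρ + 1) / ρ * (y - a) ≤ D y - D a := by
      rw [div_mul_eq_mul_div, div_le_iff₀ hρ']
      linarith
    linarith)
  have := mul_le_mul_of_nonneg_left h hρ
  refine le_of_eq_of_le ?_ this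
  field_simp

theorem tangent_lt_right (H : ConvexDerivOn f D R) (ha : 0 ≤ a) (hab : a < b) (hb : b < R) :
    f a + D a * (b - a) < f b := by
  obtain ⟨x, hax, hxb⟩ := exists_between hab
  have h1 := H.tangent_le_right ha hax.le (hxb.trans hb)
  have h2 := H.tangent_le_right (ha.trans hax.le) hxb.le hb
  have h3 := H.strictMono ⟨ha, hab.trans hb⟩ ⟨ha.trans hax.le, hxb.trans hb⟩ hax
  nlinarith [mul_lt_mul_of_pos_right h3 (sub_pos.2 hxb)]

theorem le_tangent_left (H : ConvexDerivOn f D R) (ha : 0 ≤ a) (hab : a ≤ b) (hb : b < R) :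
    f b ≤ f a + D b * (b - a) := by
  rcases hab.eq_or_lt with rfl | hab'
  · simp
  have := H.le_of_chord ha hab le_rfl hab' hb
  have h1 : 0 < b - a := by linarith
  have h2 : 0 ≤ D b - D a := sub_nonneg.2 (H.mono ha hab hb)
  have h3 : 2 * (f b - f a - D a * (b - a)) ≤ (D b - D a) * (b - a) := by
    refine le_of_mul_le_mul_right ?_ h1
    linarith
  nlinarith [mul_nonneg h2 h1.le]

/-- The linearization error grows with the base point. -/
theorem bregman_mono (H : ConvexDerivOn f D R) (ha : 0 ≤ a) (hab : a ≤ b) (hc : 0 ≤ c)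
    (hR : b + c < R) :
    f (a + c) - f a - D a * c ≤ f (b + c) - f b - D b * c := by
  -- Compare derivatives in the step length: they are the increments of `D` from the two base
  -- points, ordered by `concave_diff_mono`.
  have key : ∀ x ∈ Icc 0 c, f (a + x) - f a - D a * x ≤ f (b + x) - f b - D b * x := by
    have hd : ∀ z, 0 ≤ z → z + c < R → ∀ x ∈ Icc 0 c,
        HasDerivWithinAt (fun x => f (z + x) - f z - D z * x) (D (z + x) - D z) (Ici x) x ∧
        ContinuousWithinAt (fun x => f (z + x) - f z - D z * x) (Icc 0 c) x := by
      intro z hz hzc x hx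
      have hmem : z + x ∈ Ico 0 R := ⟨add_nonneg hz hx.1, by linarith [hx.2]⟩
      have hlin : HasDerivAt (fun x => D z * x) (D z) x := by
        simpa using (hasDerivAt_id x).const_mul (D z)
      constructor
      · have h1 : HasDerivWithinAt (fun x => f (z + x)) (D (z + x) * 1) (Ici x) x :=
          HasDerivWithinAt.comp x (H.hasDerivWithinAt_Ici hmem)
            ((hasDerivAt_id x).const_add z).hasDerivWithinAt
            (fun y hy => by simpa using hy)
        rw [mul_one] at h1
        exact (h1.sub_const _).sub hlin.hasDerivWithinAt
      · have h1 : ContinuousWithinAt (fun x => f (z + x)) (Icc 0 c) x :=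
          ContinuousWithinAt.comp (t := Ico 0 R) (H.continuousOn _ hmem)
            (by fun_prop) (fun y hy => ⟨add_nonneg hz hy.1, by linarith [hy.2]⟩)
        exact (h1.sub continuousWithinAt_const).sub hlin.continuousAt.continuousWithinAt
    intro x hx
    refine image_le_of_deriv_right_le_deriv_boundary
      (f := fun x => f (a + x) - f a - D a * x) (f' := fun x => D (a + x) - D a)
      (B := fun x => f (b + x) - f b - D b * x) (B' := fun x => D (b + x) - D b)
      (fun x hx => (hd a ha (by linarith) x hx).2)
      (fun x hx => (hd a ha (by linarith) x ⟨hx.1, hx.2.le⟩).1) (by simp)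
      (fun x hx => (hd b (ha.trans hab) hR x hx).2)
      (fun x hx => (hd b (ha.trans hab) hR x ⟨hx.1, hx.2.le⟩).1)
      (fun x hx => H.concave_diff_mono ha hab hx.1 (by linarith [hx.2])) hx
  exact key c ⟨hc, le_rfl⟩

end ConvexDerivOn

/-! ### Level points of the derivative -/

/-- `s` is the point of `(ρ, R]` at which the derivative `D` reaches the level `-c`. -/
structure IsCrossing (D : ℝ → ℝ) (R ρ c s : ℝ) : Prop where
  lt : ρ < s
  le : s ≤ R
  lt_neg : ∀ t, ρ ≤ t → t < s → D t < -c
  eq_neg : s < R → D s = -c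

namespace ConvexDerivOn

variable {f D : ℝ → ℝ} {R a b c m ρ : ℝ}

theorem exists_right (H : ConvexDerivOn f D R) (ha : 0 ≤ a) (haR : a < R) {v : ℝ} (hv : D a < v) :
    ∃ t, a < t ∧ t < R ∧ D t < v := by
  have h1 : Tendsto D (𝓝[>] a) (𝓝 (D a)) := by
    refine (H.cont a ⟨ha, haR⟩).mono_left (nhdsWithin_le_of_mem ?_)
    exact mem_of_superset (Ioo_mem_nhdsGT haR) fun y hy => ⟨ha.trans hy.1.le, hy.2⟩
  obtain ⟨t, ht, ht1⟩ := ((h1.eventually_lt_const hv).and (Ioo_mem_nhdsGT haR)).exists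
  exact ⟨t, ht1.1, ht1.2, ht⟩

theorem exists_left (H : ConvexDerivOn f D R) (hb : 0 ≤ b) (hba : b < a) (haR : a < R) {v : ℝ}
    (hv : v < D a) : ∃ t, b < t ∧ t < a ∧ v < D t := by
  have h1 : Tendsto D (𝓝[<] a) (𝓝 (D a)) := by
    refine (H.cont a ⟨hb.trans hba.le, haR⟩).mono_left (nhdsWithin_le_of_mem ?_)
    exact mem_of_superset (Ioo_mem_nhdsLT hba) fun y hy => ⟨hb.trans hy.1.le, hy.2.trans haR⟩
  obtain ⟨t, ht, ht1⟩ := ((h1.eventually_const_lt hv).and (Ioo_mem_nhdsLT hba)).exists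
  exact ⟨t, ht1.1, ht1.2, ht⟩

theorem isCrossing_sSup (H : ConvexDerivOn f D R) (hρ : 0 ≤ ρ) (hρR : ρ < R) (hc : D ρ < -c) :
    IsCrossing D R ρ c (sSup {t | t ∈ Ico ρ R ∧ c + D t < 0}) := by
  set S := {t | t ∈ Ico ρ R ∧ c + D t < 0} with hS
  have hmem : ρ ∈ S := ⟨⟨le_rfl, hρR⟩, by linarith⟩
  have hbdd : BddAbove S := ⟨R, fun t ht => ht.1.2.le⟩
  have hρs : ρ ≤ sSup S := le_csSup hbdd hmem
  have hstep : ∀ t, ρ ≤ t → t < R → D t < -c → t < sSup S := fun t ht htR htc => by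
    obtain ⟨y, hty, hyR, hyc⟩ := H.exists_right (hρ.trans ht) htR htc
    exact hty.trans_le (le_csSup hbdd ⟨⟨ht.trans hty.le, hyR⟩, by linarith⟩)
  have hlt : ∀ t, ρ ≤ t → t < sSup S → D t < -c := fun t ht hts => by
    obtain ⟨y, hy, hty⟩ := exists_lt_of_lt_csSup ⟨ρ, hmem⟩ hts
    have := H.strictMono ⟨hρ.trans ht, hty.trans hy.1.2⟩ ⟨hρ.trans hy.1.1, hy.1.2⟩ hty
    linarith [hy.2]
  have h0 := hstep ρ le_rfl hρR hc
  refine ⟨h0, csSup_le ⟨ρ, hmem⟩ fun t ht => ht.1.2.le, hlt, fun hsR => ?_⟩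
  apply le_antisymm
  · by_contra! h
    obtain ⟨t, ht1, ht2, ht3⟩ := H.exists_left hρ h0 hsR h
    exact absurd (hlt t ht1.le ht2) (not_lt.2 ht3.le)
  · by_contra! h
    exact lt_irrefl _ (hstep _ hρs hsR h)

end ConvexDerivOn

/-! ### The recentred majorant function and the constant `κ` -/

/-- The gap `f x + 2ρ + κ |D ρ| (x - ρ)` between the recentred majorant function and its supporting
line of slope `-κ` through the origin. -/
noncomputable def gap (f D : ℝ → ℝ) (ρ κ x : ℝ) : ℝ := f x + 2 * ρ + κ * (-D ρ) * (x - ρ)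

/-- The scalar data of a majorant function recentred at `ρ`. -/
structure Recentred (f D : ℝ → ℝ) (R ρ κ : ℝ) : Prop extends ConvexDerivOn f D R where
  rho_nonneg : 0 ≤ ρ
  rho_lt : ρ < R
  zero_pos : 0 < f 0
  kappa_pos : 0 < κ
  kappa_lt : κ < -D ρ
  gap_nonneg : ∀ x, ρ < x → x < R → 0 ≤ gap f D ρ κ x
  gap_inf : ∀ δ, 0 < δ → ∃ x, ρ < x ∧ x < R ∧ gap f D ρ κ x < δ
  le_mul : f ρ + 2 * ρ ≤ -D ρ * (f 0 + 2 * ρ)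

namespace ConvexDerivOn

variable {f D : ℝ → ℝ} {R ρ : ℝ}

/-- Since `D ≥ -1`, the function `t ↦ f t + t` does not fall below `f 0`. -/
theorem value_ge (H : ConvexDerivOn f D R) (hρ : 0 ≤ ρ) (hρR : ρ < R) :
    f 0 + ρ ≤ f ρ + 2 * ρ := by
  have := H.tangent_le_right le_rfl hρ hρR
  rw [H.zero] at this
  linarith

theorem recentred (H : ConvexDerivOn f D R) (hρ : 0 ≤ ρ) (h0 : 0 < f 0)
    (hβ : 2 * ρ < sSup ((fun t => -f t) '' Ico 0 R)) (hR : 0 < R) :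
    Recentred f D R ρ (sSup ((fun t => -(f t + 2 * ρ) / (|D ρ| * (t - ρ))) '' Ioo ρ R)) := by
  obtain ⟨_, ⟨t, ht, rfl⟩, hlt⟩ := exists_lt_of_lt_csSup
    ((nonempty_Ico.2 hR).image _) hβ
  have hρt : ρ < t := by
    by_contra! h
    have := H.value_ge ht.1 ht.2
    dsimp only at hlt
    linarith
  dsimp only at hlt
  have hρR := hρt.trans ht.2
  set P := f ρ + 2 * ρ with hP
  have hPge := H.value_ge hρ hρR
  have hu1 : -D ρ ≤ 1 := by
    have := H.mono le_rfl hρ hρR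
    rw [H.zero] at this
    linarith
  have hu : 0 < -D ρ := by
    by_contra! h
    have h1 := H.tangent_le_right hρ hρt.le ht.2
    nlinarith
  set u := -D ρ with hudef
  have habs : |D ρ| = u := by rw [abs_of_neg (by linarith)]
  rw [habs]
  set κ := sSup ((fun t => -(f t + 2 * ρ) / (u * (t - ρ))) '' Ioo ρ R) with hκ
  have hP0 : 0 < P := by linarith
  have hRρ : 0 < R - ρ := by linarith
  -- the uniform bound for the quotients
  have hbound : ∀ x, ρ < x → x < R →
      -(f x + 2 * ρ) / (u * (x - ρ)) ≤ u - P / (2 * u * (R - ρ)) := fun x hx hxR => by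
    have hxρ : 0 < x - ρ := by linarith
    rw [div_le_iff₀ (by positivity)]
    have key : P / 2 - u ^ 2 * (x - ρ) ≤ f x + 2 * ρ := by
      rcases hρ.eq_or_lt with h | h
      · have h1 := H.tangent_le_right hρ hx.le hxR
        have h2 : u = 1 := by rw [hudef, ← h, H.zero]; norm_num
        have h3 : D ρ = -1 := by linarith
        rw [h2]; rw [h3] at h1
        nlinarith
      · have h1 := H.strong_convex hρ le_rfl hx.le hxR
        have h2 : D ρ = -u := by rw [hudef]; ring
        rw [h2] at h1
        have h3 : 0 ≤ (1 - u) * (x - ρ - u * ρ) ^ 2 := mul_nonneg (by linarith) (sq_nonneg _)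
        have h4 : u ^ 2 * (1 - u) ≤ 1 := by nlinarith
        have h5 : ρ * (u ^ 2 * (1 - u)) ≤ ρ * 1 := mul_le_mul_of_nonneg_left h4 hρ
        refine le_of_mul_le_mul_left ?_ h
        have h6 : ρ * (ρ * (u ^ 2 * (1 - u))) ≤ ρ * P :=
          mul_le_mul_of_nonneg_left (by linarith) hρ
        nlinarith
    have h1 : P / (2 * u * (R - ρ)) * (u * (x - ρ)) ≤ P / 2 := by
      rw [div_mul_eq_mul_div, div_le_div_iff₀ (by positivity) (by norm_num)]
      have : P * u * (x - ρ) ≤ P * u * (R - ρ) :=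
        mul_le_mul_of_nonneg_left (by linarith) (by positivity)
      linarith
    nlinarith
  have hbdd : BddAbove ((fun t => -(f t + 2 * ρ) / (u * (t - ρ))) '' Ioo ρ R) :=
    ⟨_, by rintro _ ⟨x, hx, rfl⟩; exact hbound x hx.1 hx.2⟩
  have hne : ((fun t => -(f t + 2 * ρ) / (u * (t - ρ))) '' Ioo ρ R).Nonempty :=
    ⟨_, t, ⟨hρt, ht.2⟩, rfl⟩
  have hκle : κ ≤ u - P / (2 * u * (R - ρ)) :=
    csSup_le hne (by rintro _ ⟨x, hx, rfl⟩; exact hbound x hx.1 hx.2)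
  have hpos : 0 < P / (2 * u * (R - ρ)) := by positivity
  refine
    { H with
      rho_nonneg := hρ
      rho_lt := hρR
      zero_pos := h0
      kappa_pos := ?_
      kappa_lt := by linarith
      gap_nonneg := fun x hx hxR => ?_
      gap_inf := fun δ hδ => ?_
      le_mul := ?_ }
  · refine lt_of_lt_of_le ?_ (le_csSup hbdd ⟨t, ⟨hρt, ht.2⟩, rfl⟩)
    exact div_pos (by linarith) (mul_pos hu (by linarith))
  · have h1 := le_csSup hbdd ⟨x, ⟨hx, hxR⟩, rfl⟩
    have h2 : 0 < x - ρ := by linarith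
    rw [← hκ, div_le_iff₀ (by positivity)] at h1
    unfold gap
    rw [← hudef]
    linarith
  · obtain ⟨_, ⟨x, hx, rfl⟩, hlt⟩ := exists_lt_of_lt_csSup hne
      (show κ - δ / (u * (R - ρ)) < κ by linarith [show 0 < δ / (u * (R - ρ)) by positivity])
    refine ⟨x, hx.1, hx.2, ?_⟩
    have h2 : 0 < x - ρ := by linarith [hx.1]
    dsimp only at hlt
    rw [lt_div_iff₀ (by positivity)] at hlt
    unfold gap
    rw [← hudef]
    have h3 : δ / (u * (R - ρ)) * (u * (x - ρ)) ≤ δ := by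
      rw [div_mul_eq_mul_div, div_le_iff₀ (by positivity)]
      have : u * (x - ρ) ≤ u * (R - ρ) := mul_le_mul_of_nonneg_left (by linarith [hx.2]) hu.le
      exact mul_le_mul_of_nonneg_left this hδ.le
    linarith
  · rw [← hP, ← hudef]
    rcases hρ.eq_or_lt with h | h
    · have h2 : u = 1 := by rw [hudef, ← h, H.zero]; norm_num
      rw [h2, hP, ← h]
      linarith
    · have h1 := H.strong_convex hρ le_rfl hρt.le ht.2
      have h2 := H.le_of_chord le_rfl hρ le_rfl h hρR
      have h3 : D ρ = -u := by rw [hudef]; ring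
      rw [H.zero, h3] at h2
      rw [h3] at h1
      -- Trapezoidal upper bound for the integral of `D` over `[0, ρ]`.
      have h4 : 2 * (f ρ - f 0 + ρ) ≤ (1 - u) * ρ := by
        refine le_of_mul_le_mul_left ?_ h
        linarith
      -- `f t + 2ρ < 0` limits the initial value
      have h5 : 2 * (1 - u) * P ≤ u ^ 2 * ρ := by
        have h6 : ρ * (P - u * (t - ρ)) + (1 - u) * (t - ρ) ^ 2 / 2 ≤ 0 := by nlinarith
        rcases hu1.eq_or_lt with h7 | h7
        · rw [h7]; nlinarith
        · have h8 : 0 < 1 - u := by linarith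
          refine le_of_mul_le_mul_left ?_ h
          nlinarith [mul_le_mul_of_nonneg_left h6 h8.le, sq_nonneg ((1 - u) * (t - ρ) - u * ρ)]
      nlinarith

end ConvexDerivOn

/-! ### The scalar majorizing sequence -/

/-- One step of the scalar Newton iteration for the pairs `(s, ε)` that majorize the distance to the
starting point and the accumulated residuals. -/
noncomputable def scalarStep (f D : ℝ → ℝ) (ρ θ : ℝ) (p : ℝ × ℝ) : ℝ × ℝ :=
  (p.1 + (1 + θ) * (f p.1 + 2 * ρ + p.2) / -D p.1, p.2 + 2 * θ * (f p.1 + 2 * ρ + p.2))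

/-- The scalar majorizing sequence. -/
noncomputable def scalarSeq (f D : ℝ → ℝ) (ρ θ : ℝ) (k : ℕ) : ℝ × ℝ :=
  (scalarStep f D ρ θ)^[k] (ρ, 0)

/-- The first component of the scalar majorizing sequence. -/
noncomputable def majPoint (f D : ℝ → ℝ) (ρ θ : ℝ) (k : ℕ) : ℝ := (scalarSeq f D ρ θ k).1

/-- The majorant of the residual at the `k`-th iterate. -/
noncomputable def majRes (f D : ℝ → ℝ) (ρ θ : ℝ) (k : ℕ) : ℝ :=
  f (scalarSeq f D ρ θ k).1 + 2 * ρ + (scalarSeq f D ρ θ k).2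

/-- The accumulated residuals after `k` steps. -/
noncomputable def majAcc (f D : ℝ → ℝ) (ρ θ : ℝ) (k : ℕ) : ℝ := (scalarSeq f D ρ θ k).2

section

variable (f D : ℝ → ℝ) (ρ θ : ℝ) (k : ℕ)

theorem majPoint_zero : majPoint f D ρ θ 0 = ρ := rfl

theorem majAcc_zero : majAcc f D ρ θ 0 = 0 := rfl

theorem majRes_eq : majRes f D ρ θ k = f (majPoint f D ρ θ k) + 2 * ρ + majAcc f D ρ θ k := rfl

theorem majRes_zero : majRes f D ρ θ 0 = f ρ + 2 * ρ := by
  rw [majRes_eq, majPoint_zero, majAcc_zero, add_zero]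

theorem majPoint_succ : majPoint f D ρ θ (k + 1) =
    majPoint f D ρ θ k + (1 + θ) * majRes f D ρ θ k / -D (majPoint f D ρ θ k) := by
  simp only [majPoint, scalarSeq, Function.iterate_succ_apply']
  rfl

theorem majAcc_succ : majAcc f D ρ θ (k + 1) = majAcc f D ρ θ k + 2 * θ * majRes f D ρ θ k := by
  simp only [majAcc, scalarSeq, Function.iterate_succ_apply']
  rfl

end

namespace Recentred

variable {f D : ℝ → ℝ} {R ρ κ θ σ : ℝ}

theorem slope_le_one (H : Recentred f D R ρ κ) : -D ρ ≤ 1 := by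
  have := H.mono le_rfl H.rho_nonneg H.rho_lt
  rw [H.zero] at this
  linarith

theorem kappa_lt_one (H : Recentred f D R ρ κ) : κ < 1 := H.kappa_lt.trans_le H.slope_le_one

theorem slope_pos (H : Recentred f D R ρ κ) : 0 < -D ρ := H.kappa_pos.trans H.kappa_lt

theorem value_pos (H : Recentred f D R ρ κ) : 0 < f ρ + 2 * ρ := by
  linarith [H.value_ge H.rho_nonneg H.rho_lt, H.zero_pos, H.rho_nonneg]

/-- The supporting line is approached near the crossing point of the slope `-κ |D ρ|`. -/
theorem gap_inf_left (H : Recentred f D R ρ κ) (hσ : IsCrossing D R ρ (κ * -D ρ) σ) {x₁ δ : ℝ}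
    (hx₁ : x₁ < σ) (hδ : 0 < δ) : ∃ x, x₁ < x ∧ ρ < x ∧ x < σ ∧ gap f D ρ κ x < δ := by
  obtain ⟨y, hρy, hyR, hy⟩ := H.gap_inf (δ / 2) (by linarith)
  have hmax : max x₁ ρ < σ := max_lt hx₁ hσ.lt
  have hρ := H.rho_nonneg
  rcases lt_or_ge y σ with hyσ | hyσ
  -- Left of `σ` the gap decreases, so moving from `y` towards `σ` keeps it below `δ`.
  · obtain ⟨x, hx, hxσ⟩ := exists_between (max_lt hmax hyσ)
    have h1 := (le_max_left x₁ ρ).trans_lt ((le_max_left _ _).trans_lt hx)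
    have h2 := (le_max_right x₁ ρ).trans_lt ((le_max_left _ _).trans_lt hx)
    have h3 := (le_max_right (max x₁ ρ) y).trans_lt hx
    refine ⟨x, h1, h2, hxσ, ?_⟩
    have h4 := H.le_tangent_left (hρ.trans hρy.le) h3.le (hxσ.trans_le hσ.le)
    have h5 := hσ.lt_neg x h2.le hxσ
    unfold gap at hy ⊢
    nlinarith
  · have hσR : σ < R := hyσ.trans_lt hyR
    have hRpos : 0 < R := (hρ.trans_lt H.rho_lt)
    have heq := hσ.eq_neg hσR
    -- Beyond `σ` the gap increases; just left of `σ` its slope exceeds `-δ/(2R)`, so the tangent at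
    -- `x` costs at most `δ/2` on the way to `y`.
    obtain ⟨x, hx, hxσ, hDx⟩ := H.exists_left (le_max_of_le_right hρ) hmax hσR
      (show -(κ * -D ρ) - δ / (2 * R) < D σ by
        rw [heq]; linarith [show 0 < δ / (2 * R) by positivity])
    have h1 := (le_max_left x₁ ρ).trans_lt hx
    have h2 := (le_max_right x₁ ρ).trans_lt hx
    refine ⟨x, h1, h2, hxσ, ?_⟩
    have h4 := H.tangent_le_right (hρ.trans h2.le) (hxσ.le.trans hyσ) hyR
    have h5 : δ / (2 * R) * (y - x) ≤ δ / 2 := by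
      rw [div_mul_eq_mul_div, div_le_div_iff₀ (by positivity) (by norm_num)]
      nlinarith
    have h6 := mul_le_mul_of_nonneg_right hDx.le (show 0 ≤ y - x by linarith)
    unfold gap at hy ⊢
    nlinarith

theorem gap_le (H : Recentred f D R ρ κ) {s x : ℝ} (hs : ρ ≤ s) (hsx : s ≤ x) (hx : x < R) :
    gap f D ρ κ s ≤ gap f D ρ κ x + (-D s - κ * -D ρ) * (x - s) := by
  have := H.tangent_le_right (H.rho_nonneg.trans hs) hsx hx
  unfold gap
  linarith

/-- With `h = |D s|`, the tangent at `s` and a nearly vanishing gap at `x < σ` give `G` at most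
about `(h - κ|D ρ|)(x - s)`. The condition on `θ` gives `(1+θ)(h - κ|D ρ|) ≤ (1-θ)h`, so the step
stays short of `x`; the small positive gap is paid from half of the slack. -/
theorem point_lt (H : Recentred f D R ρ κ) (hσ : IsCrossing D R ρ (κ * -D ρ) σ) (hθ0 : 0 ≤ θ)
    (hθ : 2 * θ ≤ κ * (1 + θ)) {s G : ℝ} (hs : ρ ≤ s) (hsσ : s < σ) (hG : G ≤ gap f D ρ κ s) :
    s + (1 + θ) * G / -D s < σ := by
  have hκu : 0 < κ * -D ρ := mul_pos H.kappa_pos H.slope_pos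
  have hh := hσ.lt_neg s hs hsσ
  have hh0 : 0 < -D s := by linarith
  have hhu : -D s ≤ -D ρ := neg_le_neg (H.mono H.rho_nonneg hs (hsσ.trans_le hσ.le))
  set x₁ := (s + σ) / 2 with hx₁
  obtain ⟨x, hx, -, hxσ, hgap⟩ := H.gap_inf_left hσ (x₁ := x₁) (δ := κ * -D ρ * (x₁ - s) / 2)
    (by linarith) (by have : 0 < x₁ - s := by linarith
                      positivity)
  have hsx : s < x := by linarith
  have h1 := H.gap_le hs hsx.le (hxσ.trans_le hσ.le)
  have h2 : (1 + θ) * G < -D s * (x - s) := by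
    have h5 : 2 * θ * -D s ≤ κ * (1 + θ) * -D ρ :=
      (mul_le_mul_of_nonneg_right hθ hh0.le).trans
        (mul_le_mul_of_nonneg_left hhu (by have := H.kappa_pos; positivity))
    have h7 : G < κ * -D ρ * (x - s) / 2 + (-D s - κ * -D ρ) * (x - s) := by
      have := mul_lt_mul_of_pos_left hx hκu
      linarith
    have h8 := mul_lt_mul_of_pos_left h7 (show 0 < 1 + θ by linarith)
    have := mul_le_mul_of_nonneg_right h5 (sub_nonneg.2 hsx.le)
    nlinarith
  have h3 : (1 + θ) * G / -D s < x - s := by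
    rw [div_lt_iff₀ hh0]
    linarith
  linarith

/-- With `Δ = s' - s`, `w = x - s` and `c = κ|D ρ|`, the chord of `D` from `s` to `x` near `σ`
bounds twice the error by `(h - c)Δ²/w`. One factor `Δ` is exchanged for `(1+θ)G/h`, the other is
compared with `w`; each exchange yields a factor `1 - θ`, up to `δ`. -/
theorem contraction (H : Recentred f D R ρ κ) (hσ : IsCrossing D R ρ (κ * -D ρ) σ) (hθ0 : 0 ≤ θ)
    (hθ : 2 * θ ≤ κ * (1 + θ)) {s s' G : ℝ} (hs : ρ ≤ s) (hsσ : s < σ) (hG0 : 0 < G)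
    (hG : G ≤ gap f D ρ κ s) (hs' : s' = s + (1 + θ) * G / -D s) :
    f s' - f s - D s * (s' - s) ≤ (1 - θ) ^ 2 / 2 * G := by
  have hκu : 0 < κ * -D ρ := mul_pos H.kappa_pos H.slope_pos
  have hh := hσ.lt_neg s hs hsσ
  have hh0 : 0 < -D s := by linarith
  have hhu : -D s ≤ -D ρ := neg_le_neg (H.mono H.rho_nonneg hs (hsσ.trans_le hσ.le))
  have hs'σ : s' < σ := hs' ▸ H.point_lt hσ hθ0 hθ hs hsσ hG
  have hΔ : -D s * (s' - s) = (1 + θ) * G := by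
    rw [hs', add_sub_cancel_left, mul_comm, div_mul_cancel₀ _ hh0.ne']
  have hΔ0 : 0 < s' - s := by
    rw [hs', add_sub_cancel_left]
    positivity
  have hθ1 : θ ≤ 1 := by nlinarith [H.kappa_lt_one]
  have hq : (1 + θ) * (-D s - κ * -D ρ) ≤ (1 - θ) * -D s := by
    have h5 : 2 * θ * -D s ≤ κ * (1 + θ) * -D ρ :=
      (mul_le_mul_of_nonneg_right hθ hh0.le).trans
        (mul_le_mul_of_nonneg_left hhu (by have := H.kappa_pos; positivity))
    linarith
  refine le_of_forall_pos_le_add fun δ hδ => ?_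
  obtain ⟨x, hx, -, hxσ, hgap⟩ := H.gap_inf_left hσ hs'σ hδ
  have hsx : s < x := by linarith
  have hGx := hG.trans ((H.gap_le hs hsx.le (hxσ.trans_le hσ.le)))
  have hB := H.le_of_chord (H.rho_nonneg.trans hs) (by linarith : s ≤ s') hx.le hsx
    (hxσ.trans_le hσ.le)
  have hDx := hσ.lt_neg x (hs.trans hsx.le) hxσ
  set h := -D s with hdef
  set c := κ * -D ρ with hc
  set Δ := s' - s with hΔdef
  set w := x - s with hw
  have hwΔ : Δ ≤ w := by linarith
  have hw0 : 0 < w := by linarith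
  have hB2 : 2 * w * (f s' - f s - D s * Δ) ≤ (h - c) * Δ ^ 2 := by
    refine hB.trans (mul_le_mul_of_nonneg_right (by linarith) (sq_nonneg _))
  -- first replace one factor of the square by the residual
  have h1 : (h - c) * Δ ^ 2 ≤ (1 - θ) * G * Δ := by
    refine le_of_mul_le_mul_left ?_ hh0
    calc h * ((h - c) * Δ ^ 2) = (h - c) * Δ * (h * Δ) := by ring
      _ = (1 + θ) * (h - c) * (G * Δ) := by rw [hΔ]; ring
      _ ≤ (1 - θ) * h * (G * Δ) := mul_le_mul_of_nonneg_right hq (by positivity)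
      _ = h * ((1 - θ) * G * Δ) := by ring
  have h2 : h * Δ ≤ (1 + θ) * δ + (1 - θ) * h * w := by
    rw [hΔ]
    have := mul_le_mul_of_nonneg_left (hGx.trans (add_le_add_left hgap.le _))
      (show 0 ≤ 1 + θ by linarith)
    have := mul_le_mul_of_nonneg_right hq hw0.le
    linarith
  have h3 : G * Δ ≤ Δ * δ + (1 - θ) * G * w := by
    refine le_of_mul_le_mul_left ?_ hh0
    calc h * (G * Δ) = G * (h * Δ) := by ring
      _ ≤ G * ((1 + θ) * δ + (1 - θ) * h * w) := mul_le_mul_of_nonneg_left h2 hG0.le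
      _ = (1 + θ) * G * δ + h * ((1 - θ) * G * w) := by ring
      _ = h * (Δ * δ + (1 - θ) * G * w) := by rw [← hΔ]; ring
  have h4 : (1 - θ) * (Δ * δ) ≤ w * δ := by
    have : Δ * δ ≤ w * δ := mul_le_mul_of_nonneg_right hwΔ hδ.le
    nlinarith [mul_pos hΔ0 hδ]
  have h5 := mul_le_mul_of_nonneg_left h3 (show 0 ≤ 1 - θ by linarith)
  have h6 : 2 * w * (f s' - f s - D s * Δ) ≤ 2 * w * ((1 - θ) ^ 2 / 2 * G + δ) := by
    nlinarith [mul_pos hw0 hδ]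
  exact le_of_mul_le_mul_left h6 (by linarith)

/-- The invariants of the scalar majorizing sequence. -/
theorem majSeq_invariant (H : Recentred f D R ρ κ) (hσ : IsCrossing D R ρ (κ * -D ρ) σ)
    (hθ0 : 0 ≤ θ) (hθ : 2 * θ ≤ κ * (1 + θ)) (k : ℕ) :
    ρ ≤ majPoint f D ρ θ k ∧ majPoint f D ρ θ k < σ ∧ 0 < majRes f D ρ θ k ∧
      majAcc f D ρ θ k ≤ κ * -D ρ * (majPoint f D ρ θ k - ρ) ∧
      majRes f D ρ θ k ≤ ((1 + θ ^ 2) / 2) ^ k * (f ρ + 2 * ρ) := by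
  induction k with
  | zero =>
    rw [majPoint_zero, majAcc_zero, majRes_zero]
    exact ⟨le_rfl, hσ.lt, H.value_pos, by simp, by simp⟩
  | succ k ih =>
    obtain ⟨h1, h2, h3, h4, h5⟩ := ih
    have hκu : 0 < κ * -D ρ := mul_pos H.kappa_pos H.slope_pos
    have hh0 : 0 < -D (majPoint f D ρ θ k) := by linarith [hσ.lt_neg _ h1 h2]
    have hhu : -D (majPoint f D ρ θ k) ≤ -D ρ :=
      neg_le_neg (H.mono H.rho_nonneg h1 (h2.trans_le hσ.le))
    have hG : majRes f D ρ θ k ≤ gap f D ρ κ (majPoint f D ρ θ k) := by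
      rw [majRes_eq]
      unfold gap
      linarith
    have hs' := majPoint_succ f D ρ θ k
    have hlt := H.point_lt hσ hθ0 hθ h1 h2 hG
    rw [← hs'] at hlt
    have hcon := H.contraction hσ hθ0 hθ h1 h2 h3 hG hs'
    have hΔ : -D (majPoint f D ρ θ k) * (majPoint f D ρ θ (k + 1) - majPoint f D ρ θ k) =
        (1 + θ) * majRes f D ρ θ k := by
      rw [hs', add_sub_cancel_left, mul_comm, div_mul_cancel₀ _ hh0.ne']
    have hΔ0 : 0 < majPoint f D ρ θ (k + 1) - majPoint f D ρ θ k := by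
      rw [hs', add_sub_cancel_left]
      positivity
    -- The accumulated term was designed for this identity: `-(1+θ)G` from the Newton step and
    -- `+2θG` from `ε` leave `θG`.
    have hres : majRes f D ρ θ (k + 1) = θ * majRes f D ρ θ k +
        (f (majPoint f D ρ θ (k + 1)) - f (majPoint f D ρ θ k) -
          D (majPoint f D ρ θ k) * (majPoint f D ρ θ (k + 1) - majPoint f D ρ θ k)) := by
      have e1 := majRes_eq f D ρ θ k
      have e2 := majRes_eq f D ρ θ (k + 1)
      have e3 := majAcc_succ f D ρ θ k
      linarith
    refine ⟨by linarith, hlt, ?_, ?_, ?_⟩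
    · have := H.tangent_lt_right (H.rho_nonneg.trans h1) (by linarith : majPoint f D ρ θ k <
        majPoint f D ρ θ (k + 1)) (hlt.trans_le hσ.le)
      have := mul_nonneg hθ0 h3.le
      linarith
    · rw [majAcc_succ]
      have e1 := mul_le_mul_of_nonneg_right hθ h3.le
      have e2 := mul_le_mul_of_nonneg_left
        (mul_le_mul_of_nonneg_right hhu hΔ0.le) H.kappa_pos.le
      rw [hΔ] at e2
      linarith
    · rw [pow_succ]
      have e1 : majRes f D ρ θ (k + 1) ≤ (1 + θ ^ 2) / 2 * majRes f D ρ θ k := by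
        rw [hres]
        nlinarith
      have e2 := mul_le_mul_of_nonneg_left h5 (show 0 ≤ (1 + θ ^ 2) / 2 by positivity)
      linarith

end Recentred

/-! ### Sharper localization of the majorizing sequence -/

namespace Recentred

variable {f D : ℝ → ℝ} {R ρ κ θ σ l : ℝ}

theorem majPoint_one (f D : ℝ → ℝ) (ρ θ : ℝ) :
    majPoint f D ρ θ 1 = ρ + (1 + θ) * (f ρ + 2 * ρ) / -D ρ := by
  rw [majPoint_succ, majPoint_zero, majRes_zero]

theorem majPoint_lt_succ (H : Recentred f D R ρ κ) (hσ : IsCrossing D R ρ (κ * -D ρ) σ)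
    (hθ0 : 0 ≤ θ) (hθ : 2 * θ ≤ κ * (1 + θ)) (k : ℕ) :
    majPoint f D ρ θ k < majPoint f D ρ θ (k + 1) := by
  obtain ⟨h1, h2, h3, -, -⟩ := H.majSeq_invariant hσ hθ0 hθ k
  have hκu : 0 < κ * -D ρ := mul_pos H.kappa_pos H.slope_pos
  have hh0 : 0 < -D (majPoint f D ρ θ k) := by linarith [hσ.lt_neg _ h1 h2]
  rw [majPoint_succ]
  have : 0 < (1 + θ) * majRes f D ρ θ k / -D (majPoint f D ρ θ k) := by positivity
  linarith

theorem majPoint_monotone (H : Recentred f D R ρ κ) (hσ : IsCrossing D R ρ (κ * -D ρ) σ)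
    (hθ0 : 0 ≤ θ) (hθ : 2 * θ ≤ κ * (1 + θ)) : Monotone (majPoint f D ρ θ) :=
  monotone_nat_of_le_succ fun k => (H.majPoint_lt_succ hσ hθ0 hθ k).le

/-- Improved localization of the majorizing sequence: after the first step the accumulated residuals
grow with slope at most `κ |D s₁|`. -/
theorem majPoint_le_of_support (H : Recentred f D R ρ κ) (hσ : IsCrossing D R ρ (κ * -D ρ) σ)
    (hθ0 : 0 ≤ θ) (hθ : 2 * θ ≤ κ * (1 + θ)) {x : ℝ} (hx1 : majPoint f D ρ θ 1 ≤ x) (hxR : x < R)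
    (hx : f x + 2 * ρ + κ * -D ρ * (majPoint f D ρ θ 1 - ρ) +
      κ * -D (majPoint f D ρ θ 1) * (x - majPoint f D ρ θ 1) ≤ 0) (k : ℕ) :
    majPoint f D ρ θ k ≤ x := by
  have hmono := H.majPoint_monotone hσ hθ0 hθ
  have key : ∀ k, majPoint f D ρ θ (k + 1) ≤ x ∧
      majAcc f D ρ θ (k + 1) ≤ κ * -D ρ * (majPoint f D ρ θ 1 - ρ) +
        κ * -D (majPoint f D ρ θ 1) * (majPoint f D ρ θ (k + 1) - majPoint f D ρ θ 1) := by
    intro k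
    induction k with
    | zero =>
      refine ⟨hx1, ?_⟩
      simpa using (H.majSeq_invariant hσ hθ0 hθ 1).2.2.2.1
    | succ k ih =>
      obtain ⟨ih1, ih2⟩ := ih
      obtain ⟨h1, h2, h3, -, -⟩ := H.majSeq_invariant hσ hθ0 hθ (k + 1)
      have hs1 : majPoint f D ρ θ 1 ≤ majPoint f D ρ θ (k + 1) := hmono (by omega)
      have h0 := (H.majSeq_invariant hσ hθ0 hθ 1).1
      have hlt := H.majPoint_lt_succ hσ hθ0 hθ (k + 1)
      have hκu : 0 < κ * -D ρ := mul_pos H.kappa_pos H.slope_pos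
      have hs' := majPoint_succ f D ρ θ (k + 1)
      have hacc := majAcc_succ f D ρ θ (k + 1)
      have hres := majRes_eq f D ρ θ (k + 1)
      have hh0 : 0 < -D (majPoint f D ρ θ (k + 1)) := by linarith [hσ.lt_neg _ h1 h2]
      have hΔ : -D (majPoint f D ρ θ (k + 1)) *
          (majPoint f D ρ θ (k + 1 + 1) - majPoint f D ρ θ (k + 1)) =
          (1 + θ) * majRes f D ρ θ (k + 1) := by
        rw [hs', add_sub_cancel_left, mul_comm, div_mul_cancel₀ _ hh0.ne']
      have hhu := neg_le_neg (H.mono (H.rho_nonneg.trans h0) hs1 (ih1.trans_lt hxR))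
      have htan := H.tangent_le_right (H.rho_nonneg.trans h1) ih1 hxR
      set s := majPoint f D ρ θ (k + 1)
      set s' := majPoint f D ρ θ (k + 1 + 1)
      set s₁ := majPoint f D ρ θ 1
      set G := majRes f D ρ θ (k + 1)
      have hG : G ≤ (-D s - κ * -D s₁) * (x - s) := by linarith
      have hq : 2 * θ * -D s ≤ κ * (1 + θ) * -D s₁ :=
        (mul_le_mul_of_nonneg_right hθ hh0.le).trans
          (mul_le_mul_of_nonneg_left hhu (by have := H.kappa_pos; positivity))
      constructor
      · have e1 := mul_le_mul_of_nonneg_left hG (show 0 ≤ 1 + θ by linarith)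
        have e2 : -D s * (s' - s) ≤ -D s * (x - s) := by
          rw [hΔ]
          have e3 := mul_le_mul_of_nonneg_right hq (sub_nonneg.2 ih1)
          have e4 : 0 ≤ θ * -D s * (x - s) :=
            mul_nonneg (mul_nonneg hθ0 hh0.le) (sub_nonneg.2 ih1)
          linarith
        have := le_of_mul_le_mul_left e2 hh0
        linarith
      · rw [hacc]
        have e1 := mul_le_mul_of_nonneg_right hθ h3.le
        have e2 := mul_le_mul_of_nonneg_left
          (mul_le_mul_of_nonneg_right hhu (sub_nonneg.2 hlt.le)) H.kappa_pos.le
        rw [hΔ] at e2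
        linarith
  cases k with
  | zero => exact (hmono (Nat.zero_le 1)).trans hx1
  | succ k => exact (key k).1

/-- The majorizing sequence stays away from the crossing point. -/
theorem exists_majPoint_le (H : Recentred f D R ρ κ) (hσ : IsCrossing D R ρ (κ * -D ρ) σ)
    (hθ0 : 0 ≤ θ) (hθ : 2 * θ ≤ κ * (1 + θ)) : ∃ x < σ, ∀ k, majPoint f D ρ θ k ≤ x := by
  obtain ⟨h1, h2, -, -, -⟩ := H.majSeq_invariant hσ hθ0 hθ 1
  have h0 := H.majPoint_lt_succ hσ hθ0 hθ 0
  rw [majPoint_zero, zero_add] at h0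
  have hu := H.strictMono ⟨H.rho_nonneg, H.rho_lt⟩
    ⟨H.rho_nonneg.trans h1, h2.trans_le hσ.le⟩ h0
  obtain ⟨y, hy1, hyσ⟩ := exists_between h2
  -- The tolerance is the gain from replacing the slope `κ|D ρ|` by `κ|D s₁|` on the stretch from
  -- `s₁` to `y`; it is positive because `D` is strictly increasing. A bound strictly below `σ`
  -- keeps the limit in the open ball of radius `R` even if `σ = R`.
  obtain ⟨x, hx, -, hxσ, hgap⟩ := H.gap_inf_left hσ hyσ
    (δ := κ * (D (majPoint f D ρ θ 1) - D ρ) * (y - majPoint f D ρ θ 1))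
    (mul_pos (mul_pos H.kappa_pos (by linarith)) (by linarith))
  refine ⟨x, hxσ, H.majPoint_le_of_support hσ hθ0 hθ (by linarith) (hxσ.trans_le hσ.le) ?_⟩
  have := mul_le_mul_of_nonneg_left hx.le
    (mul_pos H.kappa_pos (show 0 < D (majPoint f D ρ θ 1) - D ρ by linarith)).le
  unfold gap at hgap
  linarith

/-- The supporting line stays close to `f` at the crossing point of the slope `-κ`. -/
theorem gap_crossing_le (H : Recentred f D R ρ κ) (hl : IsCrossing D R ρ κ l) (hlR : l < R) :
    gap f D ρ κ l ≤ κ ^ 2 * (1 - -D ρ) * ρ / 2 := by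
  refine le_of_forall_pos_le_add fun δ hδ => ?_
  obtain ⟨y, hρy, hyR, hy⟩ := H.gap_inf δ hδ
  have hDl := hl.eq_neg hlR
  have hu1 := H.slope_le_one
  have hκ := H.kappa_pos
  have hρ := H.rho_nonneg
  have hnn : 0 ≤ κ ^ 2 * (1 - -D ρ) * ρ / 2 := by
    have : 0 ≤ 1 - -D ρ := by linarith
    positivity
  have hκu : κ * -D ρ ≤ κ := by nlinarith
  rcases le_total y l with hyl | hyl
  · have h1 := H.le_tangent_left (hρ.trans hρy.le) hyl hlR
    rw [hDl] at h1
    have h2 := mul_le_mul_of_nonneg_right hκu (sub_nonneg.2 hyl)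
    unfold gap at hy ⊢
    linarith
  · suffices h : gap f D ρ κ l ≤ gap f D ρ κ y + κ ^ 2 * (1 - -D ρ) * ρ / 2 by linarith
    rcases hρ.eq_or_lt with h | h
    · have h1 := H.tangent_le_right (hρ.trans hl.lt.le) hyl hyR
      have h2 : D ρ = -1 := by rw [← h, H.zero]
      rw [hDl] at h1
      unfold gap
      rw [h2, ← h]
      linarith
    · have h1 := H.strong_convex hρ hl.lt.le hyl hyR
      rw [hDl] at h1
      -- Completing the square: strong convexity beats the slope mismatch `κ(1 - u)` except for the
      -- loss `κ²(1 - u)ρ/2`, extremal at distance `κρ` from `l`.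
      have h2 : 0 ≤ (1 - -D ρ) * (y - l - κ * ρ) ^ 2 := mul_nonneg (by linarith) (sq_nonneg _)
      refine le_of_mul_le_mul_left ?_ h
      unfold gap
      nlinarith

/-- By `majPoint_le_of_support` it suffices that the gap at `l`, at most `κ²(1-u)ρ/2`, is covered by
the gain `κ(D s₁ + u)(l - s₁)` of the lower slope after the first step. This holds because `l - s₁ ≥
κρu/2` and `u(D s₁ + u) ≥ 1 - u`. -/
theorem majPoint_le_crossing (H : Recentred f D R ρ κ) (hσ : IsCrossing D R ρ (κ * -D ρ) σ)
    (hl : IsCrossing D R ρ κ l) (hθ0 : 0 ≤ θ) (hθ : 2 * θ ≤ κ * (1 + θ)) (k : ℕ) :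
    majPoint f D ρ θ k ≤ l := by
  rcases hl.le.eq_or_lt with rfl | hlR
  · exact ((H.majSeq_invariant hσ hθ0 hθ k).2.1.trans_le hσ.le).le
  have hgap := H.gap_crossing_le hl hlR
  have hκ := H.kappa_pos
  have hκ1 := H.kappa_lt_one
  have hu := H.slope_pos
  have hu1 := H.slope_le_one
  have hρ := H.rho_nonneg
  have hP := H.value_ge hρ H.rho_lt
  have htan := H.tangent_le_right hρ hl.lt.le hlR
  have hlow : (f ρ + 2 * ρ) - κ ^ 2 * (1 - -D ρ) * ρ / 2 ≤ -D ρ * (1 - κ) * (l - ρ) := by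
    unfold gap at hgap
    linarith
  have hs1 := majPoint_one f D ρ θ
  have hPρ : ρ ≤ f ρ + 2 * ρ := by linarith [H.zero_pos]
  have hs1u : -D ρ * (majPoint f D ρ θ 1 - ρ) = (1 + θ) * (f ρ + 2 * ρ) := by
    rw [hs1, add_sub_cancel_left, mul_comm, div_mul_cancel₀ _ hu.ne']
  have h01 := (H.majSeq_invariant hσ hθ0 hθ 1).1
  have hsl : ∀ h : majPoint f D ρ θ 1 < R, (D ρ + 1) * (majPoint f D ρ θ 1 - ρ) ≤
      ρ * (D (majPoint f D ρ θ 1) - D ρ) := H.slope_le hρ le_rfl h01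
  have hmn : ∀ h : majPoint f D ρ θ 1 < R, D ρ ≤ D (majPoint f D ρ θ 1) := H.mono hρ h01
  set u := -D ρ with hudef
  set P := f ρ + 2 * ρ
  set s₁ := majPoint f D ρ θ 1
  have hDρ : D ρ = -u := by rw [hudef]; ring
  rw [hDρ] at hsl hmn
  have hθ2 : (1 + θ) * (2 - κ) ≤ 2 := by linarith
  -- the distance of the first point from the crossing point
  have hW : κ * ρ * u / 2 ≤ l - s₁ := by
    have hpos : 0 < u * (1 - κ) * (2 - κ) := by
      have : 0 < 1 - κ := by linarith
      have : 0 < 2 - κ := by linarith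
      positivity
    refine le_of_mul_le_mul_left ?_ hpos
    have e1 := mul_le_mul_of_nonneg_right hlow (show 0 ≤ 2 - κ by linarith)
    have e2 : (1 - κ) * (2 - κ) * (u * (s₁ - ρ)) ≤ 2 * (1 - κ) * P := by
      rw [hs1u]
      have h1 := mul_le_mul_of_nonneg_right hθ2
        (show 0 ≤ (1 - κ) * P from mul_nonneg (by linarith) (by linarith))
      linarith
    have e3 : u ^ 2 * (1 - κ) * (2 - κ) + κ * (1 - u) * (2 - κ) ≤ 2 := by
      have h1 : u ^ 2 * (1 - κ) ≤ u * (1 - κ) :=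
        mul_le_mul_of_nonneg_right (by nlinarith) (by linarith)
      have h2 : u * ((1 - κ) * (2 - κ)) ≤ u * 2 :=
        mul_le_mul_of_nonneg_left (by nlinarith) hu.le
      have h3 : (1 - u) * (κ * (2 - κ)) ≤ (1 - u) * 2 :=
        mul_le_mul_of_nonneg_left (by nlinarith) (by linarith)
      have h4 := mul_le_mul_of_nonneg_right h1 (show 0 ≤ 2 - κ by linarith)
      linarith
    have e4 := mul_le_mul_of_nonneg_left e3 (mul_nonneg hκ.le hρ)
    have e5 := mul_le_mul_of_nonneg_left hPρ hκ.le
    linarith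
  have hs1l : s₁ ≤ l := by
    have : 0 ≤ κ * ρ * u / 2 := by positivity
    linarith
  have hs1R := hs1l.trans_lt hlR
  have hsl := hsl hs1R
  have hmn := hmn hs1R
  refine H.majPoint_le_of_support hσ hθ0 hθ hs1l hlR ?_ k
  have hlast : κ ^ 2 * (1 - u) * ρ / 2 ≤ κ * (D s₁ + u) * (l - s₁) := by
    rcases hρ.eq_or_lt with h | h
    · rw [← h, mul_zero, zero_div]
      exact mul_nonneg (mul_nonneg hκ.le (by linarith)) (by linarith)
    · have e1 : (1 - u) * ρ ≤ ρ * (u * (D s₁ + u)) := by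
        have h1 := mul_le_mul_of_nonneg_left hsl hu.le
        have h2 : ρ ≤ u * (s₁ - ρ) := by rw [hs1u]; nlinarith
        have h3 := mul_le_mul_of_nonneg_left h2 (show 0 ≤ 1 - u by linarith)
        linarith
      have e2 : 1 - u ≤ u * (D s₁ + u) := by
        refine le_of_mul_le_mul_left ?_ h
        linarith
      have e3 := mul_le_mul_of_nonneg_left hW
        (show 0 ≤ κ * (D s₁ + u) from mul_nonneg hκ.le (by linarith))
      have e4 := mul_le_mul_of_nonneg_left e2 (show 0 ≤ κ ^ 2 * ρ / 2 by positivity)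
      linarith
  have hgap' : f l + 2 * ρ + κ * u * (l - ρ) ≤ κ ^ 2 * (1 - u) * ρ / 2 := hgap
  linarith

/-- Lets the inverses at the iterates be bounded by `1/κ` instead of `1/(κ|D ρ|)`, as the linear
rate requires. -/
theorem kappa_le_slope (H : Recentred f D R ρ κ) (hσ : IsCrossing D R ρ (κ * -D ρ) σ)
    (hl : IsCrossing D R ρ κ l) (hθ0 : 0 ≤ θ) (hθ : 2 * θ ≤ κ * (1 + θ)) (k : ℕ) :
    κ ≤ -D (majPoint f D ρ θ k) := by
  obtain ⟨h1, h2, -, -, -⟩ := H.majSeq_invariant hσ hθ0 hθ k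
  rcases (H.majPoint_le_crossing hσ hl hθ0 hθ k).eq_or_lt with h | h
  · have := hl.eq_neg (h ▸ h2.trans_le hσ.le)
    rw [h, this, neg_neg]
  · linarith [hl.lt_neg _ h1 h]

/-- Shifting from `[0, ρ]` to `[l, l + ρ]` cannot decrease the increment of `D`, so `D (l + ρ) ≥ -κ
+ (1 - u) ≥ -κu`; thus `l + ρ` is not left of `σ`. -/
theorem crossing_sub_le (H : Recentred f D R ρ κ) (hσ : IsCrossing D R ρ (κ * -D ρ) σ)
    (hl : IsCrossing D R ρ κ l) : σ - ρ ≤ l := by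
  by_contra! h
  have h0 := hl.lt
  have hlσ : l + ρ < σ := by linarith
  have hlR : l + ρ < R := hlσ.trans_le hσ.le
  have h1 := hl.eq_neg (by linarith [H.rho_nonneg])
  have h2 := hσ.lt_neg (l + ρ) (by linarith [H.rho_nonneg]) hlσ
  have h3 := H.concave_diff_mono le_rfl (H.rho_nonneg.trans h0.le) H.rho_nonneg hlR
  rw [zero_add, H.zero, h1] at h3
  nlinarith [H.kappa_lt_one, H.slope_le_one]

end Recentred

/-! ### From the majorant function to estimates for `F` -/

section Local

variable {X Y : Type*} [NormedAddCommGroup X] [NormedSpace ℝ X]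
  [NormedAddCommGroup Y] [NormedSpace ℝ Y]

theorem invProcess_eq (F : X → Y) (C : ConvexCone ℝ Y) (z : X) (y : Y) :
    invProcess F C z y = {d | fderiv ℝ F z d - y ∈ C} :=
  Set.ext fun d => mem_invProcess F C z y d

theorem setNorm_invProcess {F : X → Y} {C : ConvexCone ℝ Y} {z : X}
    (h : SolvableInclusion (fderiv ℝ F z) C) (y : Y) :
    setNorm (invProcess F C z y) = ENNReal.ofReal (solNorm (fderiv ℝ F z) C y) := by
  rw [invProcess_eq, h.setNorm_eq]

theorem RobinsonCondition.exists_mem {F : X → Y} {C : ConvexCone ℝ Y} {z : X}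
    (h : RobinsonCondition F C z) (y : Y) : ∃ d, fderiv ℝ F z d - y ∈ C := by
  have hy : y ∈ setRange (linProcess F C z) := h ▸ mem_univ y
  obtain ⟨d, hd⟩ := hy
  exact ⟨d, (mem_invProcess F C z y d).1 hd⟩

theorem IsMajorant.convexDerivOn {F : X → Y} {Ω : Set X} {C : ConvexCone ℝ Y} {x₀ : X} {R : ℝ}
    {f : ℝ → ℝ} (h : IsMajorant F Ω C x₀ R f) : ConvexDerivOn f (dIco f R) R where
  hasDeriv t ht := ((h.contDiffOn.differentiableOn one_ne_zero) t ht).hasDerivWithinAt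
  cont := h.contDiffOn.continuousOn_derivWithin (uniqueDiffOn_Ico 0 R) le_rfl
  convex := h.deriv_convex
  strictMono := h.deriv_strictMono
  zero := h.deriv_zero

/-- The smooth inclusion `F z ∈ C` together with a majorant function at a regular point. -/
structure MajorizedInclusion (F : X → Y) (Ω : Set X) (C : ConvexCone ℝ Y) (x₀ : X) (R : ℝ)
    (f : ℝ → ℝ) : Prop where
  isOpen : IsOpen Ω
  contDiffOn : ContDiffOn ℝ 1 F Ω
  majorant : IsMajorant F Ω C x₀ R f
  solvable : SolvableInclusion (fderiv ℝ F x₀) C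

namespace MajorizedInclusion

variable {F : X → Y} {Ω : Set X} {C : ConvexCone ℝ Y} {x₀ z z' v : X} {R : ℝ} {f : ℝ → ℝ}

theorem hasFDerivAt (H : MajorizedInclusion F Ω C x₀ R f) (hz : ‖z - x₀‖ < R) :
    HasFDerivAt F (fderiv ℝ F z) z := by
  have hzΩ : z ∈ Ω := H.majorant.ball_subset (by simpa [dist_eq_norm] using hz)
  exact (((H.contDiffOn.differentiableOn one_ne_zero) z hzΩ).differentiableAt
    (H.isOpen.mem_nhds hzΩ)).hasFDerivAt

theorem solNorm_fderiv_sub_le (H : MajorizedInclusion F Ω C x₀ R f)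
    (hv : ‖z - x₀‖ + ‖z' - z‖ < R) (d : X) :
    solNorm (fderiv ℝ F x₀) C ((fderiv ℝ F z' - fderiv ℝ F z) d) ≤
      (dIco f R (‖z - x₀‖ + ‖z' - z‖) - dIco f R ‖z - x₀‖) * ‖d‖ := by
  have hz : z ∈ Metric.ball x₀ R := by
    rw [Metric.mem_ball, dist_eq_norm]
    linarith [norm_nonneg (z' - z)]
  have hz' : z' ∈ Metric.ball x₀ R := by
    rw [Metric.mem_ball, dist_eq_norm]
    have := norm_add_le (z' - z) (z - x₀)
    rw [sub_add_sub_cancel] at this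
    linarith
  by_cases hd : d = 0
  · simp [hd, H.solvable.solNorm_zero]
  have hd0 : 0 < ‖d‖ := norm_pos_iff.2 hd
  have hmono := H.majorant.convexDerivOn.mono (norm_nonneg (z - x₀))
    (le_add_of_nonneg_right (norm_nonneg (z' - z))) hv
  have h1 := H.majorant.majorizes z hz z' hz' hv
  have hmem : ‖d‖⁻¹ • d ∈ {d : X | (compLinear (invProcess F C x₀)
      (fderiv ℝ F z' - fderiv ℝ F z) d).Nonempty ∧ ‖d‖ ≤ 1} := by
    refine ⟨?_, ?_⟩
    · rw [compLinear, invProcess_eq]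
      exact H.solvable.surj _
    · rw [norm_smul, norm_inv, norm_norm, inv_mul_cancel₀ hd0.ne']
  have h2 := (le_iSup₂ (f := fun d _ => setNorm (compLinear (invProcess F C x₀)
      (fderiv ℝ F z' - fderiv ℝ F z) d)) _ hmem).trans h1
  rw [compLinear, setNorm_invProcess H.solvable,
    ENNReal.ofReal_le_ofReal_iff (by linarith)] at h2
  have h3 := H.solvable.solNorm_smul_le hd0.le
    ((fderiv ℝ F z' - fderiv ℝ F z) (‖d‖⁻¹ • d))
  rw [← map_smul, smul_smul, mul_inv_cancel₀ hd0.ne', one_smul] at h3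
  rw [mul_comm]
  exact h3.trans (mul_le_mul_of_nonneg_left h2 hd0.le)

/-- The linearization error of `F` is majorized by that of `f`. -/
theorem solNorm_linearization_le [CompleteSpace Y] (H : MajorizedInclusion F Ω C x₀ R f)
    (hv : ‖z - x₀‖ + ‖v‖ < R) {e : ℝ} (he : |e| = 1) :
    solNorm (fderiv ℝ F x₀) C (e • (F (z + v) - F z - fderiv ℝ F z v)) ≤
      f (‖z - x₀‖ + ‖v‖) - f ‖z - x₀‖ - dIco f R ‖z - x₀‖ * ‖v‖ := by
  have hf := H.majorant.convexDerivOn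
  set N := solNorm (fderiv ℝ F x₀) C with hN
  set ν := ‖z - x₀‖ with hν
  set δ := ‖v‖ with hδ
  have hν0 : 0 ≤ ν := norm_nonneg _
  have hδ0 : 0 ≤ δ := norm_nonneg _
  have hNc : Continuous N := H.solvable.continuous_solNorm
  set w : ℝ → Y := fun τ => e • (F (z + τ • v) - F z - τ • fderiv ℝ F z v) with hw
  have hin : ∀ τ ∈ Icc (0 : ℝ) 1, ν + ‖z + τ • v - z‖ = ν + τ * δ ∧ ν + τ * δ < R := by
    intro τ hτ
    refine ⟨by rw [add_sub_cancel_left, norm_smul, Real.norm_of_nonneg hτ.1], ?_⟩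
    nlinarith [mul_le_mul_of_nonneg_right hτ.2 hδ0]
  have hwd : ∀ τ ∈ Icc (0 : ℝ) 1,
      HasDerivAt w (e • ((fderiv ℝ F (z + τ • v) - fderiv ℝ F z) v)) τ := by
    intro τ hτ
    have hlt : ‖z + τ • v - x₀‖ < R := by
      have h1 := norm_add_le (z + τ • v - z) (z - x₀)
      rw [sub_add_sub_cancel] at h1
      have h2 := hin τ hτ
      linarith
    have h1 : HasDerivAt (fun τ : ℝ => z + τ • v) v τ := by
      simpa using ((hasDerivAt_id τ).smul_const v).const_add z
    have h2 := (H.hasFDerivAt hlt).comp_hasDerivAt τ h1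
    have h3 : HasDerivAt (fun τ : ℝ => τ • fderiv ℝ F z v) (fderiv ℝ F z v) τ := by
      simpa using (hasDerivAt_id τ).smul_const (fderiv ℝ F z v)
    exact ((h2.sub_const (F z)).sub h3).const_smul e
  -- `N ∘ w` need not be differentiable, but sublinearity bounds its right difference quotients by
  -- `N` of those of `w`. A Dini-derivative comparison with the scalar error then replaces
  -- integration.
  have hmain := image_le_of_liminf_slope_right_le_deriv_boundary (a := 0) (b := 1)
    (f := fun τ => N (w τ)) (B := fun τ => f (ν + τ * δ) - f ν - dIco f R ν * δ * τ)
    (B' := fun τ => dIco f R (ν + τ * δ) * δ - dIco f R ν * δ)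
    (fun τ hτ => (hNc.continuousAt.comp (hwd τ hτ).continuousAt).continuousWithinAt)
    (by simp [hw, hN, H.solvable.solNorm_zero])
    (by
      refine ContinuousOn.sub (ContinuousOn.sub ?_ continuousOn_const) (by fun_prop)
      refine hf.continuousOn.comp (by fun_prop) fun τ hτ => ?_
      exact ⟨by have := hτ.1; positivity, (hin τ hτ).2⟩)
    (by
      intro τ hτ
      have hτ' : τ ∈ Icc (0 : ℝ) 1 := ⟨hτ.1, hτ.2.le⟩
      have hm : ν + τ * δ ∈ Ico 0 R := ⟨by have := hτ.1; positivity, (hin τ hτ').2⟩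
      have h1 : HasDerivWithinAt (fun τ => f (ν + τ * δ)) (dIco f R (ν + τ * δ) * δ)
          (Ici τ) τ := by
        refine HasDerivWithinAt.comp τ (hf.hasDerivWithinAt_Ici hm) ?_ fun y hy => ?_
        · simpa using (((hasDerivAt_id τ).mul_const δ).const_add ν).hasDerivWithinAt
        · exact add_le_add_right (mul_le_mul_of_nonneg_right hy hδ0) ν
      have h2 : HasDerivAt (fun τ => dIco f R ν * δ * τ) (dIco f R ν * δ) τ := by
        simpa using (hasDerivAt_id τ).const_mul (dIco f R ν * δ)
      exact (h1.sub_const _).sub h2.hasDerivWithinAt)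
    (by
      intro τ hτ r hr
      have hτ' : τ ∈ Icc (0 : ℝ) 1 := ⟨hτ.1, hτ.2.le⟩
      have hb : N (e • ((fderiv ℝ F (z + τ • v) - fderiv ℝ F z) v)) < r := by
        -- `N` is not even, so the sign is moved into the direction `e • v`, whose norm is
        -- unchanged.
        rw [← map_smul]
        have h1 := H.solNorm_fderiv_sub_le (z := z) (z' := z + τ • v)
          (by rw [← hν, (hin τ hτ').1]; exact (hin τ hτ').2) (e • v)
        rw [← hν, (hin τ hτ').1, norm_smul, Real.norm_eq_abs, he, one_mul, sub_mul] at h1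
        exact h1.trans_lt hr
      have ht := (hNc.tendsto _).comp (hasDerivAt_iff_tendsto_slope.1 (hwd τ hτ'))
      have hev : ∀ᶠ t in 𝓝[>] τ, N (slope w τ t) < r :=
        (ht.mono_left (nhdsWithin_mono τ fun y hy => ne_of_gt hy)).eventually_lt_const hb
      refine Eventually.frequently ?_
      filter_upwards [hev, self_mem_nhdsWithin] with t ht1 ht2
      have hpos : 0 < t - τ := sub_pos.2 ht2
      refine lt_of_le_of_lt ?_ ht1
      rw [slope_def_field, div_le_iff₀ hpos]
      have h1 := H.solvable.solNorm_add_le (w τ) (w t - w τ)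
      rw [add_sub_cancel] at h1
      have h2 := H.solvable.solNorm_smul_le hpos.le (slope w τ t)
      rw [sub_smul_slope, vsub_eq_sub] at h2
      rw [← hN] at h1 h2
      linarith)
    (right_mem_Icc.2 zero_le_one)
  simpa [hw] using hmain

theorem solNorm_linearization_le_of_le [CompleteSpace Y] (H : MajorizedInclusion F Ω C x₀ R f)
    {s : ℝ} (hs : ‖z - x₀‖ ≤ s) (hv : s + ‖v‖ < R) {e : ℝ} (he : |e| = 1) :
    solNorm (fderiv ℝ F x₀) C (e • (F (z + v) - F z - fderiv ℝ F z v)) ≤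
      f (s + ‖v‖) - f s - dIco f R s * ‖v‖ :=
  (H.solNorm_linearization_le (by linarith) he).trans
    (H.majorant.convexDerivOn.bregman_mono (norm_nonneg _) hs (norm_nonneg v) hv)

theorem solNorm_fderiv_sub_base_le (H : MajorizedInclusion F Ω C x₀ R f) {s : ℝ}
    (hz : ‖z - x₀‖ ≤ s) (hs : s < R) (d : X) :
    solNorm (fderiv ℝ F x₀) C ((fderiv ℝ F z - fderiv ℝ F x₀) d) ≤ (dIco f R s + 1) * ‖d‖ := by
  have hf := H.majorant.convexDerivOn
  have h := H.solNorm_fderiv_sub_le (z := x₀) (z' := z) (by simpa using hz.trans_lt hs) d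
  simp only [sub_self, norm_zero, zero_add, hf.zero, sub_neg_eq_add] at h
  exact h.trans (mul_le_mul_of_nonneg_right
    (by linarith [hf.mono (norm_nonneg (z - x₀)) hz hs]) (norm_nonneg d))

/-- The constant is `1` for `F'(x₀)`, as `d` solves its own inclusion, plus `1 + f' s` for the
change of derivative. -/
theorem solNorm_fderiv_le (H : MajorizedInclusion F Ω C x₀ R f) {s : ℝ}
    (hz : ‖z - x₀‖ ≤ s) (hs : s < R) (d : X) :
    solNorm (fderiv ℝ F x₀) C (fderiv ℝ F z d) ≤ (2 + dIco f R s) * ‖d‖ := by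
  have h1 := H.solvable.solNorm_add_le (fderiv ℝ F x₀ d) ((fderiv ℝ F z - fderiv ℝ F x₀) d)
  have h2 := H.solNorm_fderiv_sub_base_le hz hs d
  have h3 := H.solvable.solNorm_apply_le d
  have e : fderiv ℝ F x₀ d + (fderiv ℝ F z - fderiv ℝ F x₀) d = fderiv ℝ F z d := by simp
  rw [e] at h1
  linarith

theorem exists_solution [CompleteSpace X] (H : MajorizedInclusion F Ω C x₀ R f) {s : ℝ}
    (hz : ‖z - x₀‖ ≤ s) (hs : s < R) (hD : dIco f R s < 0) (y : Y) :
    ∃ d, fderiv ℝ F z d - y ∈ C ∧ ‖d‖ ≤ solNorm (fderiv ℝ F x₀) C y / -dIco f R s := by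
  have h0 := H.majorant.convexDerivOn.mono le_rfl ((norm_nonneg _).trans hz) hs
  rw [H.majorant.convexDerivOn.zero] at h0
  obtain ⟨d, hd, hn⟩ := H.solvable.exists_of_perturbation (A' := fderiv ℝ F z)
    (a := dIco f R s + 1) (by linarith) (by linarith) (H.solNorm_fderiv_sub_base_le hz hs) y
  refine ⟨d, hd, hn.trans (le_of_eq ?_)⟩
  congr 1
  ring

theorem solvable_of_le [CompleteSpace X] (H : MajorizedInclusion F Ω C x₀ R f) {s : ℝ}
    (hz : ‖z - x₀‖ ≤ s) (hs : s < R) (hD : dIco f R s < 0) :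
    SolvableInclusion (fderiv ℝ F z) C :=
  { H.solvable with
    surj := fun y => (H.exists_solution hz hs hD y).imp fun _ h => h.1 }

theorem solNorm_le_of_le [CompleteSpace X] (H : MajorizedInclusion F Ω C x₀ R f) {s : ℝ}
    (hz : ‖z - x₀‖ ≤ s) (hs : s < R) (hD : dIco f R s < 0) (y : Y) :
    solNorm (fderiv ℝ F z) C y ≤ solNorm (fderiv ℝ F x₀) C y / -dIco f R s := by
  obtain ⟨d, hd, hn⟩ := H.exists_solution hz hs hD y
  exact (solNorm_le hd).trans hn

theorem admissible_iff (H : MajorizedInclusion F Ω C x₀ R f) {θ : ℝ} (hθ : 0 ≤ θ) {r : Y} :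
    Admissible F C x₀ θ z r ↔
      solNorm (fderiv ℝ F x₀) C (-r) ≤ θ * solNorm (fderiv ℝ F x₀) C (-F z) ∧
        solNorm (fderiv ℝ F x₀) C r ≤ θ * solNorm (fderiv ℝ F x₀) C (-F z) := by
  have hnn := mul_nonneg hθ (solNorm_nonneg (fderiv ℝ F x₀) C (-F z))
  rw [Admissible, setNorm_invProcess H.solvable, setNorm_invProcess H.solvable,
    setNorm_invProcess H.solvable, ← ENNReal.ofReal_mul hθ, max_le_iff,
    ENNReal.ofReal_le_ofReal_iff hnn, ENNReal.ofReal_le_ofReal_iff hnn]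

theorem admissible_zero (H : MajorizedInclusion F Ω C x₀ R f) {θ : ℝ} (hθ : 0 ≤ θ) :
    Admissible F C x₀ θ z 0 := by
  rw [H.admissible_iff hθ, neg_zero, and_self, H.solvable.solNorm_zero]
  exact mul_nonneg hθ (solNorm_nonneg _ _ _)

theorem exists_isMinNormStep (h : SolvableInclusion (fderiv ℝ F z) C) (r : Y) :
    ∃ d, IsMinNormStep F C z r d := by
  have e : ∀ d, fderiv ℝ F z d - -(F z + r) = F z + fderiv ℝ F z d + r := fun d => by abel
  obtain ⟨d, hd, hmin⟩ := h.exists_min (-(F z + r))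
  refine ⟨d, e d ▸ hd, fun d' hd' => ?_⟩
  rw [hmin]
  exact solNorm_le ((e d').symm ▸ hd')

/-- The estimates for a single step of the inexact Newton method. -/
theorem newton_step_estimates [CompleteSpace X] [CompleteSpace Y]
    (H : MajorizedInclusion F Ω C x₀ R f) {θ s : ℝ} (hθ : 0 ≤ θ) (hz : ‖z - x₀‖ ≤ s) (hs : s < R)
    (hD : dIco f R s < 0) (hstep : IsNewtonStep F C x₀ θ z z') :
    -dIco f R s * ‖z' - z‖ ≤ (1 + θ) * solNorm (fderiv ℝ F x₀) C (-F z) ∧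
    (1 - θ) * solNorm (fderiv ℝ F x₀) C (-F z) ≤ (2 + dIco f R s) * ‖z' - z‖ ∧
    (s + ‖z' - z‖ < R → solNorm (fderiv ℝ F x₀) C (-F z') ≤
      f (s + ‖z' - z‖) - f s - dIco f R s * ‖z' - z‖ +
        θ * solNorm (fderiv ℝ F x₀) C (-F z)) := by
  obtain ⟨r, d, hr, ⟨hd, hmin⟩, rfl⟩ := hstep
  rw [H.admissible_iff hθ] at hr
  rw [add_sub_cancel_left]
  set N := solNorm (fderiv ℝ F x₀) C with hN
  -- The first bound compares with a solution for `-F z - r` and uses `N(-r)`. The other two use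
  -- `N(r)` and that `N(-c) = 0` for the cone element `c = F z + F'(z) d + r`.
  refine ⟨?_, ?_, fun hsd => ?_⟩
  · obtain ⟨d', hd', hn⟩ := H.exists_solution hz hs hD (-F z + -r)
    have e : fderiv ℝ F z d' - (-F z + -r) = F z + fderiv ℝ F z d' + r := by abel
    have h1 := (hmin d' (e ▸ hd')).trans hn
    rw [le_div_iff₀ (by linarith)] at h1
    have h2 := H.solvable.solNorm_add_le (-F z) (-r)
    rw [← hN] at h1 h2
    linarith [hr.1]
  · have h1 := H.solvable.solNorm_add_le (fderiv ℝ F z d) (-(F z + fderiv ℝ F z d + r) + r)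
    have h2 := H.solvable.solNorm_add_le (-(F z + fderiv ℝ F z d + r)) r
    rw [H.solvable.solNorm_neg_eq_zero hd] at h2
    have h3 := H.solNorm_fderiv_le hz hs d
    have e : fderiv ℝ F z d + (-(F z + fderiv ℝ F z d + r) + r) = -F z := by abel
    rw [e] at h1
    rw [← hN] at h1 h2 h3
    linarith [hr.2]
  · have h0 := H.solNorm_linearization_le_of_le (v := d) hz hsd (e := -1) (by simp)
    have h1 := H.solvable.solNorm_add_le ((-1 : ℝ) • (F (z + d) - F z - fderiv ℝ F z d))
      (-(F z + fderiv ℝ F z d + r) + r)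
    have h2 := H.solvable.solNorm_add_le (-(F z + fderiv ℝ F z d + r)) r
    rw [H.solvable.solNorm_neg_eq_zero hd] at h2
    have e : (-1 : ℝ) • (F (z + d) - F z - fderiv ℝ F z d) +
        (-(F z + fderiv ℝ F z d + r) + r) = -F (z + d) := by
      rw [neg_smul, one_smul]
      abel
    rw [e] at h1
    rw [← hN] at h0 h1 h2
    linarith [hr.2]

end MajorizedInclusion

end Local

/-! ### Majorization of the iterates and convergence -/

theorem ConvexDerivOn.bregman_mono_right {f D : ℝ → ℝ} {R a b c : ℝ} (H : ConvexDerivOn f D R)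
    (ha : 0 ≤ a) (hb : 0 ≤ b) (hbc : b ≤ c) (hc : a + c < R) :
    f (a + b) - f a - D a * b ≤ f (a + c) - f a - D a * c := by
  have h1 := H.tangent_le_right (a := a + b) (b := a + c) (by linarith) (by linarith) hc
  have h2 := H.mono ha (show a ≤ a + b by linarith) (by linarith)
  have h3 := mul_le_mul_of_nonneg_right h2 (sub_nonneg.2 hbc)
  linarith

/-- A sequence majorized by a bounded monotone real sequence converges. -/
theorem exists_limit_of_majorized {X : Type*} [NormedAddCommGroup X] [CompleteSpace X]
    {z : ℕ → X} {s : ℕ → ℝ} {b : ℝ} (hs : Monotone s) (hb : ∀ k, s k ≤ b)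
    (hz : ∀ k, ‖z (k + 1) - z k‖ ≤ s (k + 1) - s k) :
    ∃ x S, Tendsto z atTop (𝓝 x) ∧ S ≤ b ∧ ∀ k, s k ≤ S ∧ ‖x - z k‖ ≤ S - s k := by
  have hbdd : BddAbove (range s) := ⟨b, by rintro _ ⟨k, rfl⟩; exact hb k⟩
  have hlim := tendsto_atTop_ciSup hs hbdd
  set S := ⨆ k, s k
  have hsS : ∀ k, s k ≤ S := fun k => le_ciSup hbdd k
  have hdist : ∀ k i, ‖z (k + i) - z k‖ ≤ s (k + i) - s k := by
    intro k i
    induction i with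
    | zero => simp
    | succ i ih =>
      have h1 := norm_add_le (z (k + i + 1) - z (k + i)) (z (k + i) - z k)
      rw [sub_add_sub_cancel] at h1
      have h2 := hz (k + i)
      rw [← add_assoc]
      linarith
  have hcau : CauchySeq z := by
    refine cauchySeq_of_le_tendsto_0' (fun n => S - s n) (fun n m hnm => ?_) ?_
    · obtain ⟨i, rfl⟩ := Nat.exists_eq_add_of_le hnm
      rw [dist_comm, dist_eq_norm]
      linarith [hdist n i, hsS (n + i)]
    · simpa using hlim.const_sub S
  obtain ⟨x, hx⟩ := cauchySeq_tendsto_of_complete hcau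
  refine ⟨x, S, hx, ciSup_le hb, fun k => ⟨hsS k, ?_⟩⟩
  have ht : Tendsto (fun i => ‖z (k + i) - z k‖) atTop (𝓝 ‖x - z k‖) := by
    have := ((tendsto_add_atTop_iff_nat k).2 hx).sub_const (z k) |>.norm
    simpa [add_comm] using this
  exact le_of_tendsto' ht fun i => by linarith [hdist k i, hsS (k + i)]

section Iteration

variable {X Y : Type*} [NormedAddCommGroup X] [NormedSpace ℝ X]
  [NormedAddCommGroup Y] [NormedSpace ℝ Y]

/-- The situation of the semi-local convergence theorem. -/
structure NewtonSetting (F : X → Y) (Ω : Set X) (C : ConvexCone ℝ Y) (x₀ : X) (R : ℝ)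
    (f : ℝ → ℝ) (ρ κ σ l θ : ℝ) (z₀ : X) : Prop where
  majorized : MajorizedInclusion F Ω C x₀ R f
  recentred : Recentred f (dIco f R) R ρ κ
  crossing : IsCrossing (dIco f R) R ρ (κ * -dIco f R ρ) σ
  crossing' : IsCrossing (dIco f R) R ρ κ l
  theta_nonneg : 0 ≤ θ
  theta_le : 2 * θ ≤ κ * (1 + θ)
  start : ‖z₀ - x₀‖ ≤ ρ
  init : solNorm (fderiv ℝ F x₀) C (-F x₀) ≤ f 0

namespace NewtonSetting

variable {F : X → Y} {Ω : Set X} {C : ConvexCone ℝ Y} {x₀ z₀ : X} {R : ℝ} {f : ℝ → ℝ}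
  {ρ κ σ l θ : ℝ} {z : ℕ → X}

theorem theta_lt_one (T : NewtonSetting F Ω C x₀ R f ρ κ σ l θ z₀) : θ < 1 := by
  nlinarith [T.theta_le, T.recentred.kappa_lt_one, T.theta_nonneg]

theorem slope_neg (T : NewtonSetting F Ω C x₀ R f ρ κ σ l θ z₀) (k : ℕ) :
    dIco f R (majPoint f (dIco f R) ρ θ k) < 0 := by
  have := T.recentred.kappa_le_slope T.crossing T.crossing' T.theta_nonneg T.theta_le k
  linarith [T.recentred.kappa_pos]

theorem norm_sub_base_le (T : NewtonSetting F Ω C x₀ R f ρ κ σ l θ z₀) {x : X} {s : ℝ}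
    (h : ‖x - z₀‖ ≤ s - ρ) : ‖x - x₀‖ ≤ s := by
  have := norm_add_le (x - z₀) (z₀ - x₀)
  rw [sub_add_sub_cancel] at this
  linarith [T.start]

variable [CompleteSpace Y]

/-- The origin of the shift `2ρ`: linearizing at `x₀` costs `f ν - f 0 + ν` and applying `F'(x₀)` to
the displacement of length `ν` costs another `ν`. The sum `f ν + 2ν` is nondecreasing in `ν ≤ ρ`. -/
theorem start_residual (T : NewtonSetting F Ω C x₀ R f ρ κ σ l θ z₀) :
    solNorm (fderiv ℝ F x₀) C (-F z₀) ≤ f ρ + 2 * ρ := by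
  have H := T.majorized
  have hf := H.majorant.convexDerivOn
  have hρR := T.recentred.rho_lt
  have h0 := H.solNorm_linearization_le (z := x₀) (v := z₀ - x₀) (e := -1)
    (by simpa using T.start.trans_lt hρR) (by simp)
  simp only [sub_self, norm_zero, zero_add, hf.zero, add_sub_cancel] at h0
  have h1 := H.solvable.solNorm_add_le
    ((-1 : ℝ) • (F z₀ - F x₀ - fderiv ℝ F x₀ (z₀ - x₀)))
    (-F x₀ + fderiv ℝ F x₀ (-(z₀ - x₀)))
  have h2 := H.solvable.solNorm_add_le (-F x₀) (fderiv ℝ F x₀ (-(z₀ - x₀)))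
  have h3 := H.solvable.solNorm_apply_le (-(z₀ - x₀))
  rw [norm_neg] at h3
  have e : (-1 : ℝ) • (F z₀ - F x₀ - fderiv ℝ F x₀ (z₀ - x₀)) +
      (-F x₀ + fderiv ℝ F x₀ (-(z₀ - x₀))) = -F z₀ := by
    rw [neg_smul, one_smul, map_neg]
    abel
  rw [e] at h1
  have h4 := hf.tangent_le_right (norm_nonneg (z₀ - x₀)) T.start hρR
  have h5 := hf.mono le_rfl (norm_nonneg (z₀ - x₀)) (T.start.trans_lt hρR)
  rw [hf.zero] at h5
  have h6 := mul_le_mul_of_nonneg_right h5 (sub_nonneg.2 T.start)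
  linarith [T.init, T.start]

variable [CompleteSpace X]

/-- The iterates are majorized by the scalar sequence. -/
theorem iterate_majorized (T : NewtonSetting F Ω C x₀ R f ρ κ σ l θ z₀) (h0 : z 0 = z₀) (n : ℕ)
    (hz : ∀ k < n, IsNewtonStep F C x₀ θ (z k) (z (k + 1))) :
    ‖z n - z₀‖ ≤ majPoint f (dIco f R) ρ θ n - ρ ∧
      solNorm (fderiv ℝ F x₀) C (-F (z n)) ≤ majRes f (dIco f R) ρ θ n ∧
      ∀ k < n, ‖z (k + 1) - z k‖ ≤
        majPoint f (dIco f R) ρ θ (k + 1) - majPoint f (dIco f R) ρ θ k := by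
  have H := T.majorized
  have S := T.recentred
  induction n with
  | zero =>
    refine ⟨by simp [h0, majPoint_zero], ?_, by simp⟩
    rw [majRes_zero, h0]
    exact T.start_residual
  | succ n ih =>
    obtain ⟨ih1, ih2, ih3⟩ := ih fun k hk => hz k (by omega)
    obtain ⟨i1, i2, i3, -, -⟩ := S.majSeq_invariant T.crossing T.theta_nonneg T.theta_le n
    have j2 := (S.majSeq_invariant T.crossing T.theta_nonneg T.theta_le (n + 1)).2.1
    have hD := T.slope_neg n
    have hball : ‖z n - x₀‖ ≤ majPoint f (dIco f R) ρ θ n := by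
      have := norm_add_le (z n - z₀) (z₀ - x₀)
      rw [sub_add_sub_cancel] at this
      linarith [T.start]
    obtain ⟨e1, -, e3⟩ := H.newton_step_estimates T.theta_nonneg hball (i2.trans_le T.crossing.le)
      hD (hz n (by omega))
    have hs' := majPoint_succ f (dIco f R) ρ θ n
    have r1 := majRes_eq f (dIco f R) ρ θ n
    have r2 := majRes_eq f (dIco f R) ρ θ (n + 1)
    have r3 := majAcc_succ f (dIco f R) ρ θ n
    set s := majPoint f (dIco f R) ρ θ n
    set s' := majPoint f (dIco f R) ρ θ (n + 1)
    set G := majRes f (dIco f R) ρ θ n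
    have hΔ : -dIco f R s * (s' - s) = (1 + θ) * G := by
      rw [hs', add_sub_cancel_left, mul_comm, div_mul_cancel₀ _ (by linarith)]
    have hθ := T.theta_nonneg
    have hd : ‖z (n + 1) - z n‖ ≤ s' - s := by
      refine le_of_mul_le_mul_left ?_ (neg_pos.2 hD)
      rw [hΔ]
      exact e1.trans (mul_le_mul_of_nonneg_left ih2 (by linarith))
    have hs'R : s' < R := j2.trans_le T.crossing.le
    refine ⟨?_, ?_, ?_⟩
    · have := norm_add_le (z (n + 1) - z n) (z n - z₀)
      rw [sub_add_sub_cancel] at this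
      linarith
    -- The scalar error grows with the step length, so the true step may be replaced by `s' - s`;
    -- the recursion for `G` closes the induction.
    · have b1 := H.majorant.convexDerivOn.bregman_mono_right (S.rho_nonneg.trans i1)
        (norm_nonneg (z (n + 1) - z n)) hd (by linarith)
      have b2 := e3 (by linarith)
      have b3 := mul_le_mul_of_nonneg_left ih2 hθ
      rw [add_sub_cancel] at b1
      linarith
    · intro k hk
      rcases Nat.lt_succ_iff_lt_or_eq.1 hk with hk | rfl
      · exact ih3 k hk
      · exact hd

/-- No finite run of the method can get stuck. -/
theorem well_defined (T : NewtonSetting F Ω C x₀ R f ρ κ σ l θ z₀) (h0 : z 0 = z₀) (n : ℕ)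
    (hz : ∀ k < n, IsNewtonStep F C x₀ θ (z k) (z (k + 1))) :
    z n ∈ Ω ∧ (∃ r : Y, Admissible F C x₀ θ (z n) r) ∧ ∀ r : Y, ∃ d, IsMinNormStep F C (z n) r d := by
  have h1 := T.norm_sub_base_le (T.iterate_majorized h0 n hz).1
  have h2 := ((T.recentred.majSeq_invariant T.crossing T.theta_nonneg T.theta_le n).2.1).trans_le
    T.crossing.le
  refine ⟨T.majorized.majorant.ball_subset ?_, ⟨0, T.majorized.admissible_zero T.theta_nonneg⟩,
    fun r => MajorizedInclusion.exists_isMinNormStep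
      (T.majorized.solvable_of_le h1 h2 (T.slope_neg n)) r⟩
  rw [Metric.mem_ball, dist_eq_norm]
  exact h1.trans_lt h2

theorem residual_le (T : NewtonSetting F Ω C x₀ R f ρ κ σ l θ z₀) (h0 : z 0 = z₀)
    (hz : ∀ k, IsNewtonStep F C x₀ θ (z k) (z (k + 1))) (k : ℕ) :
    solNorm (fderiv ℝ F x₀) C (-F (z k)) ≤ ((1 + θ ^ 2) / 2) ^ k * (f ρ + 2 * ρ) :=
  (T.iterate_majorized h0 k fun k _ => hz k).2.1.trans
    (T.recentred.majSeq_invariant T.crossing T.theta_nonneg T.theta_le k).2.2.2.2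

theorem setNorm_residual_le (T : NewtonSetting F Ω C x₀ R f ρ κ σ l θ z₀) (h0 : z 0 = z₀)
    (hz : ∀ k, IsNewtonStep F C x₀ θ (z k) (z (k + 1))) (k : ℕ) :
    setNorm (invProcess F C z₀ (-F (z k))) ≤
      ENNReal.ofReal (((1 + θ ^ 2) / 2) ^ k * (f 0 + 2 * ρ)) := by
  have hu := T.recentred.slope_pos
  rw [setNorm_invProcess (T.majorized.solvable_of_le T.start T.recentred.rho_lt (by linarith))]
  apply ENNReal.ofReal_le_ofReal
  refine (T.majorized.solNorm_le_of_le T.start T.recentred.rho_lt (by linarith) _).trans ?_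
  rw [div_le_iff₀ hu]
  have h1 := mul_le_mul_of_nonneg_left T.recentred.le_mul
    (show 0 ≤ ((1 + θ ^ 2) / 2) ^ k by positivity)
  linarith [T.residual_le h0 hz k]

theorem exists_limit (T : NewtonSetting F Ω C x₀ R f ρ κ σ l θ z₀) (h0 : z 0 = z₀)
    (hz : ∀ k, IsNewtonStep F C x₀ θ (z k) (z (k + 1))) :
    ∃ xs S, Tendsto z atTop (𝓝 xs) ∧ S < σ ∧ S ≤ l ∧ F xs ∈ C ∧
      ∀ k, majPoint f (dIco f R) ρ θ k ≤ S ∧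
        ‖xs - z k‖ ≤ S - majPoint f (dIco f R) ρ θ k := by
  have hmaj := fun n => T.iterate_majorized h0 n fun k _ => hz k
  obtain ⟨b, hbσ, hb⟩ := T.recentred.exists_majPoint_le T.crossing T.theta_nonneg T.theta_le
  have hl := T.recentred.majPoint_le_crossing T.crossing T.crossing' T.theta_nonneg T.theta_le
  obtain ⟨xs, S, hx, hS, hxS⟩ := exists_limit_of_majorized (z := z)
    (T.recentred.majPoint_monotone T.crossing T.theta_nonneg T.theta_le)
    -- Both bounds are needed: `b < σ` places the limit in `Ω`, and `l` gives the closed ball about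
    -- `x₀`.
    (fun k => le_min (hb k) (hl k)) (fun k => (hmaj (k + 1)).2.2 k (by omega))
  have hSσ : S < σ := (hS.trans (min_le_left _ _)).trans_lt hbσ
  refine ⟨xs, S, hx, hSσ, hS.trans (min_le_right _ _), ?_, hxS⟩
  have hxR : ‖xs - x₀‖ < R := by
    refine (T.norm_sub_base_le ?_).trans_lt (hSσ.trans_le T.crossing.le)
    have := (hxS 0).2
    rwa [h0, majPoint_zero] at this
  have hNc : Continuous (solNorm (fderiv ℝ F x₀) C) := T.majorized.solvable.continuous_solNorm
  have ht := (hNc.tendsto _).comp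
    (((T.majorized.hasFDerivAt hxR).continuousAt.tendsto.comp hx).neg)
  have hθ1 : (1 + θ ^ 2) / 2 < 1 := by nlinarith [T.theta_lt_one, T.theta_nonneg]
  have hgeo := (tendsto_pow_atTop_nhds_zero_of_lt_one (by positivity) hθ1).mul_const (f ρ + 2 * ρ)
  rw [zero_mul] at hgeo
  refine T.majorized.solvable.mem_of_solNorm_neg_eq_zero (le_antisymm ?_ (solNorm_nonneg _ _ _))
  exact le_of_tendsto_of_tendsto' ht hgeo fun k => T.residual_le h0 hz k

end NewtonSetting

end Iteration

/-! ### Step-to-step estimates and the linear rate -/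

namespace Recentred

variable {f : ℝ → ℝ} {R ρ κ σ : ℝ}

/-- For the convex `D`, chord slopes ending at `σ` are at most the left derivative there. This turns
the chord bound on the linearization error into a quadratic one with a constant independent of `s`.
-/
theorem leftDerivD_nonneg_and_le (H : Recentred f (dIco f R) R ρ κ) (hρσ : ρ < σ) (hσR : σ < R) :
    0 ≤ leftDerivD f R σ ∧ ∀ s δ, ρ ≤ s → s < σ → 0 ≤ δ → s + δ ≤ σ →
      f (s + δ) - f s - dIco f R s * δ ≤ leftDerivD f R σ / 2 * δ ^ 2 := by
  have hmem : ∀ s, ρ ≤ s → s < R → s ∈ Ico 0 R := fun s h1 h2 => ⟨H.rho_nonneg.trans h1, h2⟩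
  have hint : σ ∈ interior (Ico 0 R) := by
    rw [interior_Ico]
    exact ⟨H.rho_nonneg.trans_lt hρσ, hσR⟩
  have hsl : ∀ s, ρ ≤ s → s < σ → dIco f R σ - dIco f R s ≤ leftDerivD f R σ * (σ - s) := by
    intro s h1 h2
    have := H.convex.slope_le_leftDeriv_of_mem_interior (hmem s h1 (h2.trans hσR)) hint h2
    rw [slope_def_field, div_le_iff₀ (by linarith)] at this
    exact this
  constructor
  · have h1 := hsl ρ le_rfl hρσ
    have h2 := H.mono H.rho_nonneg hρσ.le hσR
    by_contra! h
    nlinarith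
  · intro s δ h1 h2 h3 h4
    have h5 := H.le_of_chord (b := s + δ) (H.rho_nonneg.trans h1) (by linarith) h4 h2 hσR
    rw [add_sub_cancel_left] at h5
    have h6 := mul_le_mul_of_nonneg_right (hsl s h1 h2) (sq_nonneg δ)
    have h7 : 0 < 2 * (σ - s) := by linarith
    refine le_of_mul_le_mul_left ?_ h7
    linarith

end Recentred

/-- A sequence with a summable majorant of the increments of telescoping type. -/
theorem norm_limit_sub_le_of_telescope {X : Type*} [NormedAddCommGroup X] {z : ℕ → X} {x : X}
    {N : ℕ → ℝ} {c : ℝ} {m : ℕ} (hx : Tendsto z atTop (𝓝 x)) (hc : 0 ≤ c) (hN : ∀ k, 0 ≤ N k)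
    (h : ∀ k, m ≤ k → ‖z (k + 1) - z k‖ + c * N (k + 1) ≤ c * N k) : ‖x - z m‖ ≤ c * N m := by
  have key : ∀ i, ‖z (i + m) - z m‖ + c * N (i + m) ≤ c * N m := by
    intro i
    induction i with
    | zero => simp
    | succ i ih =>
      have h1 := norm_add_le (z (i + m + 1) - z (i + m)) (z (i + m) - z m)
      rw [sub_add_sub_cancel] at h1
      have h2 := h (i + m) (by omega)
      rw [add_right_comm]
      linarith
  refine le_of_tendsto' (((tendsto_add_atTop_iff_nat m).2 hx).sub_const (z m)).norm fun i => ?_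
  linarith [key i, mul_nonneg hc (hN (i + m))]

/-- The threshold is the positive root of `(4+κ)θ² + 4(κ+1)θ = κ`, and the rate is below `1` exactly
where the left side is below the right. -/
theorem qRate_lt_one {κ θ : ℝ} (hκ : 0 < κ) (hθ0 : 0 ≤ θ) (hθ1 : θ < 1)
    (h : θ < (-2 * (κ + 1) + √(4 * (κ + 1) ^ 2 + κ * (4 + κ))) / (4 + κ)) :
    qRate κ θ < 1 := by
  rw [lt_div_iff₀ (by linarith)] at h
  have h1 : θ * (4 + κ) + 2 * (κ + 1) < √(4 * (κ + 1) ^ 2 + κ * (4 + κ)) := by linarith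
  rw [Real.lt_sqrt (by positivity)] at h1
  have h2 : (4 + κ) * θ ^ 2 + 4 * (κ + 1) * θ < κ := by
    refine lt_of_mul_lt_mul_left ?_ (show 0 ≤ 4 + κ by linarith)
    linarith
  have e : qRate κ θ = (1 + θ) * ((1 + θ) * κ + 4 * θ) / ((1 - θ) * (2 * κ)) := by
    have : 1 - θ ≠ 0 := by linarith
    unfold qRate
    field_simp
    ring
  rw [e, div_lt_one (mul_pos (by linarith) (by linarith))]
  linarith

/-- The perturbed rates `(1+θ)(θ+η)(2-κ+η) / (κ(1-θ-η))` lie below the asserted rate for small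
`η`. -/
theorem exists_rate_le_qRate {κ θ : ℝ} (hκ : 0 < κ) (hθ0 : 0 ≤ θ) (hθ1 : θ < 1) :
    ∃ η, 0 < η ∧ θ + η < 1 ∧
      (1 + θ) / (κ * (1 - θ - η)) * (θ + η) * (2 - κ + η) ≤ qRate κ θ := by
  have hpos : 0 < κ * (1 - θ - 0) := mul_pos hκ (by linarith)
  have hcont : ContinuousAt
      (fun η : ℝ => (1 + θ) / (κ * (1 - θ - η)) * (θ + η) * (2 - κ + η)) 0 := by
    refine ContinuousAt.mul (ContinuousAt.mul (ContinuousAt.div₀ (by fun_prop) (by fun_prop) ?_)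
      (by fun_prop)) (by fun_prop)
    exact hpos.ne'
  -- At `η = 0` the rate is strictly below the asserted one, which leaves room for a positive `η` by
  -- continuity.
  have hlt : (1 + θ) / (κ * (1 - θ - 0)) * (θ + 0) * (2 - κ + 0) < qRate κ θ := by
    have e : qRate κ θ - (1 + θ) / (κ * (1 - θ - 0)) * (θ + 0) * (2 - κ + 0) =
        (1 + θ) * (1 + 3 * θ) / (2 * (1 - θ)) := by
      have : 1 - θ ≠ 0 := by linarith
      unfold qRate
      rw [sub_zero, add_zero, add_zero]
      field_simp
      ring
    have : 0 < (1 + θ) * (1 + 3 * θ) / (2 * (1 - θ)) :=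
      div_pos (by positivity) (by linarith)
    linarith
  have hev := (hcont.tendsto.eventually_lt_const hlt).filter_mono
    (nhdsWithin_le_nhds (s := Ioi 0))
  obtain ⟨η, h1, h2⟩ := (hev.and (Ioo_mem_nhdsGT (show (0 : ℝ) < 1 - θ by linarith))).exists
  exact ⟨η, h2.1, by linarith [h2.2], h1.le⟩

namespace NewtonSetting

variable {X Y : Type*} [NormedAddCommGroup X] [NormedSpace ℝ X] [CompleteSpace X]
  [NormedAddCommGroup Y] [NormedSpace ℝ Y] [CompleteSpace Y]
  {F : X → Y} {Ω : Set X} {C : ConvexCone ℝ Y} {x₀ z₀ : X} {R : ℝ} {f : ℝ → ℝ}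
  {ρ κ σ l θ : ℝ} {z : ℕ → X}

/-- The estimates relating consecutive steps and residuals. -/
theorem step_estimates (T : NewtonSetting F Ω C x₀ R f ρ κ σ l θ z₀) (hσR : σ < R) (h0 : z 0 = z₀)
    (hz : ∀ k, IsNewtonStep F C x₀ θ (z k) (z (k + 1))) (k : ℕ) :
    -dIco f R (majPoint f (dIco f R) ρ θ k) * ‖z (k + 1) - z k‖ ≤
        (1 + θ) * solNorm (fderiv ℝ F x₀) C (-F (z k)) ∧
      (1 - θ) * solNorm (fderiv ℝ F x₀) C (-F (z k)) ≤ (2 - κ) * ‖z (k + 1) - z k‖ ∧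
      solNorm (fderiv ℝ F x₀) C (-F (z (k + 1))) ≤
        leftDerivD f R σ / 2 * ‖z (k + 1) - z k‖ ^ 2 +
          θ * solNorm (fderiv ℝ F x₀) C (-F (z k)) := by
  obtain ⟨m1, -, m3⟩ := T.iterate_majorized h0 (k + 1) fun k _ => hz k
  have m0 := (T.iterate_majorized h0 k fun k _ => hz k).1
  obtain ⟨i1, i2, -, -, -⟩ :=
    T.recentred.majSeq_invariant T.crossing T.theta_nonneg T.theta_le k
  have j2 := (T.recentred.majSeq_invariant T.crossing T.theta_nonneg T.theta_le (k + 1)).2.1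
  have hκ := T.recentred.kappa_le_slope T.crossing T.crossing' T.theta_nonneg T.theta_le k
  have hd := m3 k (by omega)
  obtain ⟨e1, e2, e3⟩ := T.majorized.newton_step_estimates T.theta_nonneg (T.norm_sub_base_le m0)
    (i2.trans_le T.crossing.le) (T.slope_neg k) (hz k)
  refine ⟨e1, e2.trans (mul_le_mul_of_nonneg_right (by linarith) (norm_nonneg _)), ?_⟩
  have h1 := (T.recentred.leftDerivD_nonneg_and_le T.crossing.lt hσR).2 _ _ i1 i2
    (norm_nonneg (z (k + 1) - z k)) (by linarith)
  linarith [e3 (by linarith)]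

theorem norm_step_succ_le (T : NewtonSetting F Ω C x₀ R f ρ κ σ l θ z₀) (hσR : σ < R)
    (h0 : z 0 = z₀) (hz : ∀ k, IsNewtonStep F C x₀ θ (z k) (z (k + 1))) (k : ℕ) :
    ‖z (k + 1) - z (k + 2)‖ ≤ (1 + θ) / (1 - θ) *
      ((1 + θ) / 2 * (leftDerivD f R σ / |dIco f R σ|) * ‖z (k + 1) - z k‖ +
        θ * ((2 * |dIco f R ρ| + dIco f R σ) / |dIco f R σ|)) * ‖z (k + 1) - z k‖ := by
  obtain ⟨-, a2, a3⟩ := T.step_estimates hσR h0 hz k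
  obtain ⟨b1, -, -⟩ := T.step_estimates hσR h0 hz (k + 1)
  obtain ⟨i1, i2, -, -, -⟩ :=
    T.recentred.majSeq_invariant T.crossing T.theta_nonneg T.theta_le (k + 1)
  have hκh := T.recentred.kappa_le_slope T.crossing T.crossing' T.theta_nonneg T.theta_le (k + 1)
  have hκu := T.crossing.lt_neg _ i1 i2
  have hDσ := T.crossing.eq_neg hσR
  have hL := (T.recentred.leftDerivD_nonneg_and_le T.crossing.lt hσR).1
  have hu := T.recentred.slope_pos
  have hκ := T.recentred.kappa_pos
  have hκ1 := T.recentred.kappa_lt_one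
  have hθ := T.theta_nonneg
  have hθ1 := T.theta_lt_one
  rw [norm_sub_rev (z (k + 1)) (z (k + 2))]
  have b1' : -dIco f R (majPoint f (dIco f R) ρ θ (k + 1)) * ‖z (k + 2) - z (k + 1)‖ ≤
    (1 + θ) * solNorm (fderiv ℝ F x₀) C (-F (z (k + 1))) := b1
  have hδ := norm_nonneg (z (k + 1) - z k)
  have hδ' := norm_nonneg (z (k + 2) - z (k + 1))
  set δ := ‖z (k + 1) - z k‖
  set δ' := ‖z (k + 2) - z (k + 1)‖
  set h := -dIco f R (majPoint f (dIco f R) ρ θ (k + 1)) with hh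
  set N := solNorm (fderiv ℝ F x₀) C (-F (z k))
  set N' := solNorm (fderiv ℝ F x₀) C (-F (z (k + 1)))
  set B := leftDerivD f R σ
  rw [abs_of_neg (show dIco f R ρ < 0 by linarith), hDσ, abs_neg,
    abs_of_pos (mul_pos hκ hu)]
  set u := -dIco f R ρ
  have hκu0 : 0 < κ * u := mul_pos hκ hu
  have hcoef : (2 * u + -(κ * u)) / (κ * u) = (2 - κ) / κ := by
    field_simp
    ring
  rw [hcoef]
  have hh0 : 0 < h := by linarith
  -- divide the estimate of the new step by the slope at the new point
  have c1 : (1 - θ) * h * δ' ≤ (1 + θ) * ((1 - θ) * (B / 2 * δ ^ 2) + θ * ((2 - κ) * δ)) := by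
    have h1 := mul_le_mul_of_nonneg_left b1' (show 0 ≤ 1 - θ by linarith)
    have h2 := mul_le_mul_of_nonneg_left a3 (show 0 ≤ (1 - θ) * (1 + θ) from
      mul_nonneg (by linarith) (by linarith))
    have h3 := mul_le_mul_of_nonneg_left a2 (show 0 ≤ (1 + θ) * θ by positivity)
    linarith
  -- The two terms use different lower bounds of the slope `h`: `κu` from staying left of `σ` here,
  -- and the stronger `κ` from staying left of `λ` for the linear term.
  have c2 : B / 2 * δ ^ 2 ≤ h * (B / 2 / (κ * u) * δ ^ 2) := by
    have e : h * (B / 2 / (κ * u) * δ ^ 2) = h / (κ * u) * (B / 2 * δ ^ 2) := by ring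
    rw [e]
    exact le_mul_of_one_le_left (by positivity) ((one_le_div hκu0).2 (by linarith))
  have c3 : (2 - κ) * δ ≤ h * ((2 - κ) / κ * δ) := by
    have e : h * ((2 - κ) / κ * δ) = h / κ * ((2 - κ) * δ) := by ring
    rw [e]
    exact le_mul_of_one_le_left (mul_nonneg (by linarith) hδ) ((one_le_div hκ).2 hκh)
  have c4 : (1 - θ) * δ' ≤ (1 + θ) * ((1 + θ) * (B / 2 / (κ * u) * δ ^ 2) +
      θ * ((2 - κ) / κ * δ)) := by
    refine le_of_mul_le_mul_left ?_ hh0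
    have h1 := mul_le_mul_of_nonneg_left c2 (show 0 ≤ (1 + θ) * (1 - θ) from
      mul_nonneg (by linarith) (by linarith))
    have h2 := mul_le_mul_of_nonneg_left c3 (show 0 ≤ (1 + θ) * θ by positivity)
    have h3 : 0 ≤ (1 + θ) * (2 * θ) * (h * (B / 2 / (κ * u) * δ ^ 2)) := by positivity
    linarith
  have e : (1 + θ) / (1 - θ) * ((1 + θ) / 2 * (B / (κ * u)) * δ + θ * ((2 - κ) / κ)) * δ =
      (1 + θ) * ((1 + θ) * (B / 2 / (κ * u) * δ ^ 2) + θ * ((2 - κ) / κ * δ)) / (1 - θ) := by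
    ring
  rw [e, le_div_iff₀ (by linarith)]
  linarith

theorem residual_le_norm_limit_sub (T : NewtonSetting F Ω C x₀ R f ρ κ σ l θ z₀) (hσR : σ < R)
    (h0 : z 0 = z₀) (hz : ∀ k, IsNewtonStep F C x₀ θ (z k) (z (k + 1))) {xs : X} {S : ℝ}
    (hS : S < σ) (hC : F xs ∈ C)
    (hxS : ∀ k, majPoint f (dIco f R) ρ θ k ≤ S ∧
      ‖xs - z k‖ ≤ S - majPoint f (dIco f R) ρ θ k) (k : ℕ) :
    solNorm (fderiv ℝ F x₀) C (-F (z k)) ≤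
      (2 - κ) * ‖xs - z k‖ + leftDerivD f R σ / 2 * ‖xs - z k‖ ^ 2 := by
  have H := T.majorized
  have m0 := T.norm_sub_base_le (T.iterate_majorized h0 k fun k _ => hz k).1
  obtain ⟨i1, i2, -, -, -⟩ :=
    T.recentred.majSeq_invariant T.crossing T.theta_nonneg T.theta_le k
  have hκ := T.recentred.kappa_le_slope T.crossing T.crossing' T.theta_nonneg T.theta_le k
  have hk := hxS k
  have h1 := H.solNorm_linearization_le_of_le (v := xs - z k) (e := 1) m0 (by linarith) (by simp)
  have h2 := (T.recentred.leftDerivD_nonneg_and_le T.crossing.lt hσR).2 _ _ i1 i2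
    (norm_nonneg (xs - z k)) (by linarith)
  have h3 := (H.solNorm_fderiv_le m0 (i2.trans hσR) (xs - z k)).trans
    (mul_le_mul_of_nonneg_right (show _ ≤ 2 - κ by linarith) (norm_nonneg _))
  rw [one_smul, add_sub_cancel] at h1
  have h4 := H.solvable.solNorm_add_le (F xs - F (z k) - fderiv ℝ F (z k) (xs - z k))
    (fderiv ℝ F (z k) (xs - z k) + -F xs)
  have h5 := H.solvable.solNorm_add_le (fderiv ℝ F (z k) (xs - z k)) (-F xs)
  rw [H.solvable.solNorm_neg_eq_zero hC] at h5
  have e : F xs - F (z k) - fderiv ℝ F (z k) (xs - z k) +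
      (fderiv ℝ F (z k) (xs - z k) + -F xs) = -F (z k) := by abel
  rw [e] at h4
  linarith

theorem limsup_ratio_le (T : NewtonSetting F Ω C x₀ R f ρ κ σ l θ z₀) (hσR : σ < R)
    (h0 : z 0 = z₀) (hz : ∀ k, IsNewtonStep F C x₀ θ (z k) (z (k + 1))) {xs : X} {S : ℝ}
    (hx : Tendsto z atTop (𝓝 xs)) (hS : S < σ) (hC : F xs ∈ C)
    (hxS : ∀ k, majPoint f (dIco f R) ρ θ k ≤ S ∧
      ‖xs - z k‖ ≤ S - majPoint f (dIco f R) ρ θ k) :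
    limsup (fun k => ‖xs - z (k + 1)‖ₑ / ‖xs - z k‖ₑ) atTop ≤ ENNReal.ofReal (qRate κ θ) := by
  have hκ := T.recentred.kappa_pos
  have hκ1 := T.recentred.kappa_lt_one
  have hθ := T.theta_nonneg
  have hL := (T.recentred.leftDerivD_nonneg_and_le T.crossing.lt hσR).1
  obtain ⟨η, hη, hη1, hrate⟩ := exists_rate_le_qRate hκ hθ T.theta_lt_one
  set B := leftDerivD f R σ
  set N : ℕ → ℝ := fun k => solNorm (fderiv ℝ F x₀) C (-F (z k)) with hN
  have hN0 : ∀ k, 0 ≤ N k := fun k => solNorm_nonneg _ _ _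
  have hstep : ∀ k, κ * ‖z (k + 1) - z k‖ ≤ (1 + θ) * N k := fun k =>
    (mul_le_mul_of_nonneg_right
      (T.recentred.kappa_le_slope T.crossing T.crossing' T.theta_nonneg T.theta_le k)
      (norm_nonneg _)).trans (T.step_estimates hσR h0 hz k).1
  have ht0 : Tendsto (fun k => B / 2 * ‖xs - z k‖) atTop (𝓝 0) := by
    simpa using (hx.const_sub xs).norm.const_mul (B / 2)
  have ht1 : Tendsto (fun k => B / 2 * ((1 + θ) / κ) * ‖z (k + 1) - z k‖) atTop (𝓝 0) := by
    simpa using (((tendsto_add_atTop_iff_nat 1).2 hx).sub hx).norm.const_mul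
      (B / 2 * ((1 + θ) / κ))
  obtain ⟨K, hK⟩ := eventually_atTop.1
    ((ht0.eventually_le_const hη).and (ht1.eventually_le_const hη))
  have hcon : ∀ k, K ≤ k → N (k + 1) ≤ (θ + η) * N k := by
    intro k hk
    have h1 := (T.step_estimates hσR h0 hz k).2.2
    have h2 : ‖z (k + 1) - z k‖ ≤ (1 + θ) / κ * N k := by
      rw [div_mul_eq_mul_div, le_div_iff₀ hκ]
      linarith [hstep k]
    have h3 : B / 2 * ‖z (k + 1) - z k‖ ^ 2 ≤ η * N k := by
      have h4 := mul_le_mul_of_nonneg_left h2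
        (show 0 ≤ B / 2 * ‖z (k + 1) - z k‖ by positivity)
      have h5 := mul_le_mul_of_nonneg_right (hK k hk).2 (hN0 k)
      linarith
    change N (k + 1) ≤ _ + θ * N k at h1
    linarith
  -- With this `c` each step is at most `c(1-θ-η) N k ≤ c N k - c N (k+1)`, so the tail of the
  -- sequence telescopes.
  set c := (1 + θ) / (κ * (1 - θ - η)) with hc
  have h1η : 0 < 1 - θ - η := by linarith
  have hc0 : 0 ≤ c := by positivity
  refine limsup_le_of_le (by isBoundedDefault) ?_
  filter_upwards [eventually_ge_atTop K] with k hk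
  have htail : ‖xs - z (k + 1)‖ ≤ c * N (k + 1) := by
    refine norm_limit_sub_le_of_telescope hx hc0 hN0 fun j hj => ?_
    have h1 := mul_le_mul_of_nonneg_left (hcon j (by omega)) hc0
    have h2 : ‖z (j + 1) - z j‖ ≤ c * (1 - θ - η) * N j := by
      have e : c * (1 - θ - η) = (1 + θ) / κ := by
        rw [hc]
        field_simp
      rw [e, div_mul_eq_mul_div, le_div_iff₀ hκ]
      linarith [hstep j]
    linarith
  have hres : N k ≤ (2 - κ + η) * ‖xs - z k‖ := by
    have h1 := T.residual_le_norm_limit_sub hσR h0 hz hS hC hxS k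
    have h2 := mul_le_mul_of_nonneg_right (hK k hk).1 (norm_nonneg (xs - z k))
    change N k ≤ _ at h1
    linarith
  have hfin : ‖xs - z (k + 1)‖ ≤ qRate κ θ * ‖xs - z k‖ := by
    have h1 := mul_le_mul_of_nonneg_left (hcon k hk) hc0
    have h2 := mul_le_mul_of_nonneg_left hres (show 0 ≤ c * (θ + η) by positivity)
    have h3 := mul_le_mul_of_nonneg_right hrate (norm_nonneg (xs - z k))
    linarith
  have hq : 0 ≤ qRate κ θ := by
    refine le_trans ?_ hrate
    have : 0 ≤ 2 - κ + η := by linarith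
    positivity
  -- Division in `ℝ≥0∞` has `0 / 0 = 0`, so the case of a limit reached after finitely many steps
  -- needs no separate treatment.
  refine ENNReal.div_le_of_le_mul ?_
  rw [← ofReal_norm, ← ofReal_norm, ← ENNReal.ofReal_mul hq]
  exact ENNReal.ofReal_le_ofReal hfin

end NewtonSetting

/-! ### Assembly -/

/-- The constant `μ_ρ` is the recentred crossing point of the slope `-κ_ρ |f'(ρ)|`. -/
theorem isCrossing_mu {f : ℝ → ℝ} {R ρ : ℝ}
    (H : Recentred f (dIco f R) R ρ (kappa f R ρ)) :
    IsCrossing (dIco f R) R ρ (kappa f R ρ * -dIco f R ρ) (mu f R ρ + ρ) := by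
  have hu := H.slope_pos
  have habs : |dIco f R ρ| = -dIco f R ρ := abs_of_neg (by linarith)
  have hlt : dIco f R ρ < -(kappa f R ρ * -dIco f R ρ) := by
    nlinarith [mul_lt_mul_of_pos_right H.kappa_lt_one hu]
  have key := H.isCrossing_sSup H.rho_nonneg H.rho_lt hlt
  convert key using 1
  have hset : {t | t ∈ Ico ρ R ∧ kappa f R ρ * -dIco f R ρ + dIco f R t < 0} =
      OrderIso.addRight ρ '' {t | t ∈ Ico 0 (R - ρ) ∧
        kappa f R ρ + dIco f R (t + ρ) / |dIco f R ρ| < 0} := by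
    have hiff : ∀ y, kappa f R ρ * -dIco f R ρ + y < 0 ↔
        kappa f R ρ + y / |dIco f R ρ| < 0 := fun y => by
      rw [habs, ← lt_neg_iff_add_neg', ← lt_neg_iff_add_neg', div_lt_iff₀ hu, neg_mul]
    ext t
    simp only [mem_ofPred_eq, mem_image, OrderIso.addRight_apply, mem_Ico]
    constructor
    · rintro ⟨⟨h1, h2⟩, h3⟩
      refine ⟨t - ρ, ⟨⟨by linarith, by linarith⟩, ?_⟩, by ring⟩
      rw [sub_add_cancel]
      exact (hiff _).1 h3
    · rintro ⟨y, ⟨⟨h1, h2⟩, h3⟩, rfl⟩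
      exact ⟨⟨by linarith, by linarith⟩, (hiff _).2 h3⟩
  rw [hset, ← OrderIso.map_csSup']
  · rfl
  · refine ⟨0, ⟨le_rfl, by linarith [H.rho_lt]⟩, ?_⟩
    rw [zero_add, habs, div_eq_of_eq_mul hu.ne' (show dIco f R ρ = -1 * -dIco f R ρ by ring)]
    linarith [H.kappa_lt_one]
  · exact ⟨R - ρ, fun t ht => ht.1.2.le⟩

end ConeNewton

theorem theorem1 {X Y : Type*}
    [NormedAddCommGroup X] [NormedSpace ℝ X] [CompleteSpace X]
    [NormedAddCommGroup Y] [NormedSpace ℝ Y] [CompleteSpace Y]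
    (hX : ConeNewton.IsReflexiveSpace X)
    (Ω : Set X) (hΩ : IsOpen Ω) (F : X → Y) (hF : ContDiffOn ℝ 1 F Ω)
    (C : ConvexCone ℝ Y) (hCne : (C : Set Y).Nonempty) (hCcl : IsClosed (C : Set Y))
    (R : ℝ) (hR : 0 < R) (x₀ : X) (hx₀ : x₀ ∈ Ω)
    (hRob : ConeNewton.RobinsonCondition F C x₀)
    (f : ℝ → ℝ) (hf : ConeNewton.IsMajorant F Ω C x₀ R f)
    (hinit : ConeNewton.setNorm (ConeNewton.invProcess F C x₀ (-F x₀)) ≤ ENNReal.ofReal (f 0))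
    (ρ : ℝ) (hρ0 : 0 ≤ ρ) (hρ : ρ < ConeNewton.beta f R / 2)
    (θ : ℝ) (hθ0 : 0 ≤ θ) (hθ : θ ≤ ConeNewton.thetaMax f R ρ)
    (z₀ : X) (hz₀ : z₀ ∈ Metric.ball x₀ ρ ∨ z₀ = x₀) :
    -- well-definedness: no finite run of the method can get stuck
    (∀ (n : ℕ) (z : ℕ → X), z 0 = z₀ →
      (∀ k < n, ConeNewton.IsNewtonStep F C x₀ θ (z k) (z (k + 1))) →
      z n ∈ Ω ∧ (∃ r : Y, ConeNewton.Admissible F C x₀ θ (z n) r) ∧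
        ∀ r : Y, ConeNewton.Admissible F C x₀ θ (z n) r →
          ∃ d : X, ConeNewton.IsMinNormStep F C (z n) r d) ∧
    -- properties of every sequence generated by the method
    (∀ z : ℕ → X, z 0 = z₀ →
      (∀ k, ConeNewton.IsNewtonStep F C x₀ θ (z k) (z (k + 1))) →
      (∀ k, ConeNewton.setNorm (ConeNewton.invProcess F C z₀ (-F (z k))) ≤
        ENNReal.ofReal (((1 + θ ^ 2) / 2) ^ k * (f 0 + 2 * ρ))) ∧
      (∀ k, z k ∈ Metric.ball z₀ (ConeNewton.lam f R ρ) ∧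
        z k ∈ Metric.ball z₀ (ConeNewton.mu f R ρ)) ∧
      ∃ xs : X, Tendsto z atTop (𝓝 xs) ∧
        xs ∈ Metric.closedBall x₀ (ConeNewton.lam f R ρ) ∧
        xs ∈ Metric.closedBall z₀ (ConeNewton.mu f R ρ) ∧
        xs ∈ Ω ∧ F xs ∈ C ∧
        (ConeNewton.mu f R ρ < R - ρ →
          (∀ k, ‖z (k + 1) - z (k + 2)‖ ≤
            (1 + θ) / (1 - θ) *
              ((1 + θ) / 2 *
                  (ConeNewton.leftDerivD f R (ConeNewton.mu f R ρ + ρ) /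
                    |ConeNewton.dIco f R (ConeNewton.mu f R ρ + ρ)|) *
                  ‖z (k + 1) - z k‖ +
                θ * ((2 * |ConeNewton.dIco f R ρ| +
                      ConeNewton.dIco f R (ConeNewton.mu f R ρ + ρ)) /
                    |ConeNewton.dIco f R (ConeNewton.mu f R ρ + ρ)|)) *
              ‖z (k + 1) - z k‖) ∧
          (θ < (-2 * (ConeNewton.kappa f R ρ + 1) +
                √(4 * (ConeNewton.kappa f R ρ + 1) ^ 2 +
                  ConeNewton.kappa f R ρ * (4 + ConeNewton.kappa f R ρ))) /
                (4 + ConeNewton.kappa f R ρ) →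
            limsup (fun k => ‖xs - z (k + 1)‖ₑ / ‖xs - z k‖ₑ) atTop ≤
                ENNReal.ofReal (ConeNewton.qRate (ConeNewton.kappa f R ρ) θ) ∧
              ConeNewton.qRate (ConeNewton.kappa f R ρ) θ < 1))) := by

  have hmajorized : ConeNewton.MajorizedInclusion F Ω C x₀ R f :=
    ⟨hΩ, hF, hf, hX, hCcl, ConeNewton.zero_mem_of_isClosed hCne hCcl, hRob.exists_mem⟩
  have hrec : ConeNewton.Recentred f (ConeNewton.dIco f R) R ρ (ConeNewton.kappa f R ρ) :=
    hf.convexDerivOn.recentred hρ0 hf.f_zero_pos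
      (by change 2 * ρ < ConeNewton.beta f R; linarith) hR
  have hμ := ConeNewton.isCrossing_mu hrec
  have hl : ConeNewton.IsCrossing (ConeNewton.dIco f R) R ρ (ConeNewton.kappa f R ρ)
      (ConeNewton.lam f R ρ) :=
    hrec.isCrossing_sSup hρ0 hrec.rho_lt (by linarith [hrec.kappa_lt])
  have T : ConeNewton.NewtonSetting F Ω C x₀ R f ρ (ConeNewton.kappa f R ρ)
      (ConeNewton.mu f R ρ + ρ) (ConeNewton.lam f R ρ) θ z₀ :=
    { majorized := hmajorized
      recentred := hrec
      crossing := hμ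
      crossing' := hl
      theta_nonneg := hθ0
      theta_le := by
        rw [ConeNewton.thetaMax, le_div_iff₀ (by linarith [hrec.kappa_lt_one])] at hθ
        linarith
      start := by
        rcases hz₀ with h | rfl
        · exact (by simpa [dist_eq_norm] using h : ‖z₀ - x₀‖ < ρ).le
        · simpa using hρ0
      init := by
        rwa [ConeNewton.setNorm_invProcess hmajorized.solvable,
          ENNReal.ofReal_le_ofReal_iff hf.f_zero_pos.le] at hinit }
  refine ⟨fun n z h0 hz => ?_, fun z h0 hz => ⟨T.setNorm_residual_le h0 hz, fun k => ?_, ?_⟩⟩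
  · obtain ⟨h1, h2, h3⟩ := T.well_defined h0 n hz
    exact ⟨h1, h2, fun r _ => h3 r⟩
  · have h1 := (T.iterate_majorized h0 k fun k _ => hz k).1
    have h2 := (hrec.majSeq_invariant hμ hθ0 T.theta_le k).2.1
    -- One strict bound `‖z k - z₀‖ < σ - ρ = μ` serves both balls, since `σ - ρ ≤ λ`.
    have h3 := hrec.crossing_sub_le hμ hl
    rw [Metric.mem_ball, Metric.mem_ball, dist_eq_norm]
    exact ⟨by linarith, by linarith⟩
  · obtain ⟨xs, S, hx, hSσ, hSl, hC, hxS⟩ := T.exists_limit h0 hz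
    have hdist : ‖xs - z₀‖ ≤ S - ρ := by
      have := (hxS 0).2
      rwa [h0, ConeNewton.majPoint_zero] at this
    have hbase := T.norm_sub_base_le hdist
    refine ⟨xs, hx, ?_, ?_, hf.ball_subset ?_, hC, fun hμR => ⟨?_, fun hθ' => ⟨?_, ?_⟩⟩⟩
    · rw [Metric.mem_closedBall, dist_eq_norm]
      linarith
    · rw [Metric.mem_closedBall, dist_eq_norm]
      linarith
    · rw [Metric.mem_ball, dist_eq_norm]
      linarith [hμ.le]
    · exact T.norm_step_succ_le (by linarith) h0 hz
    · exact T.limsup_ratio_le (by linarith) h0 hz hx hSσ hC hxS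
    · exact ConeNewton.qRate_lt_one hrec.kappa_pos hθ0 T.theta_lt_one hθ'
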